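/- Given two sets $\mathcal{L}_1$ and $\mathcal{L}_2$ of $t$ lines each in the Euclidean plane, let $P_0=\{\ell_1\cap\ell_2:\ell_1\in\mathcal{L}_1,\ \ell_2\in\mathcal{L}_2\}$ be the set of intersection points of a line of $\mathcal{L}_1$ with a line of $\mathcal{L}_2$. We say that $(P_0,\mathcal{L}_1\cup\mathcal{L}_2)$ is a natural $t\times t$ grid if $|P_0|=t^2$ and, for $i=1,2$, the convex hull of $P_0$ contains no intersection point of two distinct lines of $\mathcal{L}_i$. A pair $(P,\mathcal{L})$ of a finite set of points and a finite set of lines contains a natural $t\times t$ grid if there is such a grid with $P_0\subseteq P$ and $\mathcal{L}_1\cup\mathcal{L}_2\subseteq\mathcal{L}$. Theorem. There are an absolute constant $c>0$ and, for every integer $t>1$, real numbers $\varepsilon(t)\ge c/t^2$ and $C(t)>0$ such that the following holds. If $P$ is a set of $n$ points and $\mathcal{L}$ a set of $n$ lines in the plane such that $(P,\mathcal{L})$ contains no natural $t\times t$ grid, then $$|\{(p,\ell)\in P\times\mathcal{L}: p\in\ell\}|\le C(t)\, n^{\frac43-\varepsilon(t)}.$$ -/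

import Mathlib

/-- The Euclidean plane. -/
abbrev Plane : Type := EuclideanSpace ℝ (Fin 2)

/-- A line in the plane: an affine subspace whose direction has dimension one. -/
def IsLine (ℓ : AffineSubspace ℝ Plane) : Prop :=
  Module.finrank ℝ ℓ.direction = 1

/-- The set of incidences between a set of points and a set of lines. -/
def incidences (P : Finset Plane) (L : Finset (AffineSubspace ℝ Plane)) :
    Set (Plane × AffineSubspace ℝ Plane) :=
  {x | x.1 ∈ P ∧ x.2 ∈ L ∧ x.1 ∈ x.2}

/-- The set of all points in which a line of the first family and a line of the second family
intersect. -/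
def gridPoints (L₁ L₂ : Finset (AffineSubspace ℝ Plane)) : Set Plane :=
  {p | ∃ ℓ₁ ∈ L₁, ∃ ℓ₂ ∈ L₂, (ℓ₁ : Set Plane) ∩ (ℓ₂ : Set Plane) = {p}}

/-- No intersection point of two distinct lines of `L` lies in the set `K`. -/
def NoCrossingIn (L : Finset (AffineSubspace ℝ Plane)) (K : Set Plane) : Prop :=
  ∀ ℓ ∈ L, ∀ ℓ' ∈ L, ℓ ≠ ℓ' → ∀ p : Plane, p ∈ ℓ → p ∈ ℓ' → p ∉ K

/-- The families `L₁` and `L₂`, together with their intersection points, form a natural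
`t × t` grid. -/
structure IsNaturalGrid (t : ℕ) (L₁ L₂ : Finset (AffineSubspace ℝ Plane)) : Prop where
  isLine₁ : ∀ ℓ ∈ L₁, IsLine ℓ
  isLine₂ : ∀ ℓ ∈ L₂, IsLine ℓ
  card₁ : L₁.card = t
  card₂ : L₂.card = t
  card_points : (gridPoints L₁ L₂).ncard = t ^ 2
  noCrossing₁ : NoCrossingIn L₁ (convexHull ℝ (gridPoints L₁ L₂))
  noCrossing₂ : NoCrossingIn L₂ (convexHull ℝ (gridPoints L₁ L₂))

/-- The arrangement `(P, L)` contains a natural `t × t` grid. -/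
def ContainsNaturalGrid (t : ℕ) (P : Finset Plane) (L : Finset (AffineSubspace ℝ Plane)) :
    Prop :=
  ∃ L₁ L₂ : Finset (AffineSubspace ℝ Plane),
    IsNaturalGrid t L₁ L₂ ∧ L₁ ⊆ L ∧ L₂ ⊆ L ∧ gridPoints L₁ L₂ ⊆ (P : Set Plane)

/-! Work in the dual: a non-vertical line becomes the point (slope, intercept) of a set `Q`, and a
point (x, y) becomes the line of `Λ` with slope -x and intercept y. Vertical lines cost at most one
incidence per point.

The dual points are split into groups of size N, each met by few lines. A random sample of r lines
cuts the plane into at most 6r² trapezoids, and the trapezoid of an average point is met by O(n/r)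
lines (Clarkson–Shor), so by pigeonhole some N points share a trapezoid met by few lines
(`exists_group`). Removing such groups one after another (`inc_le_of_groups`) bounds the incidences
by O(n^(3/2)/√N), plus the number of pairs of consecutive points on a line within a group, plus a
remainder. The trivial bound N² per group, with N ≈ n^(1/3), gives n^(4/3); any power saving on N²
improves the exponent.

The saving is Kővári–Sós–Turán for the graph of consecutive pairs. Suppose 2t points have many
common successors. The line joining two such dual points is the dual of a point of P where the
corresponding primal lines cross. Consecutiveness makes the crossings on each primal line distinct,
and Ramsey (`exists_consistent_submatrix`) selects t + t lines on which all crossings occur in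
consistent orders. Such families form a natural grid (`not_mem_convexHull_of_consistent`). Hence a
group has O(N^(2-1/(2t))) consecutive pairs, and N ≈ n^(1/3+1/(9t)) yields the saving 1/(18t),
stronger than the required c/t². -/

/-! ### Germs of lines and crossings. -/

/-- The value at `x` of the line with slope `l.1` and intercept `l.2`. -/
def ev (l : ℝ × ℝ) (x : ℝ) : ℝ := l.1 * x + l.2

/-- The germ of the line `l` to the right of `x`, as an element of a linear order; `σ = -1`
reverses the order. -/
noncomputable def germ (σ x : ℝ) (l : ℝ × ℝ) : ℝ ×ₗ ℝ := toLex (σ * ev l x, σ * l.1)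

lemma germ_lt_iff {σ x : ℝ} {a b : ℝ × ℝ} :
    germ σ x a < germ σ x b ↔
      σ * ev a x < σ * ev b x ∨ (σ * ev a x = σ * ev b x ∧ σ * a.1 < σ * b.1) := by
  simp [germ, Prod.Lex.toLex_lt_toLex]

lemma germ_injective {σ : ℝ} (hσ : σ ≠ 0) (x : ℝ) : Function.Injective (germ σ x) := by
  rintro ⟨a, b⟩ ⟨c, d⟩ h
  simp only [germ, ev, EmbeddingLike.apply_eq_iff_eq, Prod.mk.injEq, mul_eq_mul_left_iff, hσ,
    or_false] at h
  obtain ⟨h1, h2⟩ := h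
  subst h2
  simp at h1
  simp [h1]

lemma germ_neg_lt_iff {σ x : ℝ} {a b : ℝ × ℝ} :
    germ (-σ) x a < germ (-σ) x b ↔ germ σ x b < germ σ x a := by
  simp only [germ_lt_iff, neg_mul, neg_lt_neg_iff, neg_inj]
  constructor <;> rintro (h | ⟨h, h'⟩) <;> simp [*]

lemma exists_crossing_right {σ x x' : ℝ} {a b : ℝ × ℝ} (hσ : σ ≠ 0)
    (h : germ σ x a < germ σ x b) (hx : x < x') (h' : σ * ev b x' ≤ σ * ev a x') :
    ∃ X, x < X ∧ X ≤ x' ∧ ev a X = ev b X := by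
  rw [germ_lt_iff] at h
  simp only [ev] at *
  have hs : σ * (b.1 - a.1) < 0 := by
    by_contra hs
    push Not at hs
    rcases h with h | ⟨h, h2⟩ <;> nlinarith
  have hd : 0 < σ * ((b.1 - a.1) * x + (b.2 - a.2)) := by
    rcases h with h | ⟨h, h2⟩ <;> nlinarith
  have hne : b.1 - a.1 ≠ 0 := by rintro h0; simp [h0] at hs
  refine ⟨-(b.2 - a.2) / (b.1 - a.1), ?_, ?_, ?_⟩
  · have : -(b.2 - a.2) / (b.1 - a.1) - x
        = -(σ * ((b.1 - a.1) * x + (b.2 - a.2))) / (σ * (b.1 - a.1)) := by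
      field_simp; ring
    have := div_pos_of_neg_of_neg (neg_lt_zero.2 hd) hs
    linarith
  · have e : x' - -(b.2 - a.2) / (b.1 - a.1)
        = (σ * ((b.1 - a.1) * x' + (b.2 - a.2))) / (σ * (b.1 - a.1)) := by
      field_simp; ring
    have : 0 ≤ (σ * ((b.1 - a.1) * x' + (b.2 - a.2))) / (σ * (b.1 - a.1)) :=
      div_nonneg_of_nonpos (by nlinarith) hs.le
    linarith
  · field_simp; ring

lemma exists_crossing_left {σ x x' : ℝ} {a b : ℝ × ℝ} (hσ : σ ≠ 0)
    (h : germ σ x a < germ σ x b) (hx : x' < x) (h' : σ * ev b x' < σ * ev a x') :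
    ∃ X, x' < X ∧ X ≤ x ∧ ev a X = ev b X := by
  have h1 : germ (-σ) x' a < germ (-σ) x' b := by
    rw [germ_neg_lt_iff, germ_lt_iff]; exact Or.inl h'
  refine exists_crossing_right (neg_ne_zero.2 hσ) h1 hx ?_
  rw [germ_lt_iff] at h
  rcases h with h | ⟨h, -⟩ <;> nlinarith

/-- Germs look to the right, so a crossing at `x` itself is already resolved there; only crossings
in the half-open interval can change the order. This is why cells below are half-open and no general
position is needed. -/
lemma germ_lt_germ_congr {σ x x' : ℝ} {a b : ℝ × ℝ} (hσ : σ ≠ 0) (hab : a ≠ b) (hx : x ≤ x')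
    (hX : ∀ X, x < X → X ≤ x' → ev a X ≠ ev b X) :
    germ σ x a < germ σ x b ↔ germ σ x' a < germ σ x' b := by
  rcases hx.eq_or_lt with rfl | hx
  · rfl
  have key : ∀ a b : ℝ × ℝ, (∀ X, x < X → X ≤ x' → ev a X ≠ ev b X) →
      germ σ x a < germ σ x b → σ * ev a x' < σ * ev b x' := by
    intro a b hX h
    by_contra hc
    push Not at hc
    obtain ⟨X, h1, h2, h3⟩ := exists_crossing_right hσ h hx hc
    exact hX X h1 h2 h3
  constructor
  · intro h
    exact germ_lt_iff.2 (Or.inl (key a b hX h))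
  · intro h
    rcases lt_trichotomy (germ σ x a) (germ σ x b) with h1 | h1 | h1
    · exact h1
    · exact absurd (germ_injective hσ x h1) hab
    · have := germ_lt_iff.2 (Or.inl (key b a (fun X h1 h2 => (hX X h1 h2).symm) h1))
      exact absurd this h.asymm

/-! ### Cells of the vertical decomposition. -/

/-- The lines of `R` that are next to the point `q` on its side `σ` (above if `σ = 1`, below if
`σ = -1`); ties are broken by moving infinitesimally to the right. -/
noncomputable def nb (σ : ℝ) (R : Finset (ℝ × ℝ)) (q : ℝ × ℝ) : Finset (ℝ × ℝ) :=
  open Classical in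
  R.filter fun l => σ * q.2 < σ * ev l q.1 ∧
    ∀ l' ∈ R, σ * q.2 < σ * ev l' q.1 → germ σ q.1 l ≤ germ σ q.1 l'

lemma mem_nb {σ : ℝ} {R : Finset (ℝ × ℝ)} {q l : ℝ × ℝ} :
    l ∈ nb σ R q ↔ l ∈ R ∧ σ * q.2 < σ * ev l q.1 ∧
      ∀ l' ∈ R, σ * q.2 < σ * ev l' q.1 → germ σ q.1 l ≤ germ σ q.1 l' := by
  simp [nb]

lemma nb_unique {σ : ℝ} (hσ : σ ≠ 0) {R : Finset (ℝ × ℝ)} {q l l' : ℝ × ℝ}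
    (h : l ∈ nb σ R q) (h' : l' ∈ nb σ R q) : l = l' := by
  rw [mem_nb] at h h'
  exact germ_injective hσ _ (le_antisymm (h.2.2 l' h'.1 h'.2.1) (h'.2.2 l h.1 h.2.1))

lemma exists_mem_nb {σ : ℝ} {R : Finset (ℝ × ℝ)} {q l : ℝ × ℝ} (hl : l ∈ R)
    (h : σ * q.2 < σ * ev l q.1) : ∃ u ∈ nb σ R q, germ σ q.1 u ≤ germ σ q.1 l := by
  classical
  obtain ⟨u, hu, hu'⟩ := Finset.exists_min_image
    (R.filter fun l => σ * q.2 < σ * ev l q.1) (germ σ q.1) ⟨l, by simp [hl, h]⟩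
  simp only [Finset.mem_filter] at hu hu'
  exact ⟨u, mem_nb.2 ⟨hu.1, hu.2, fun l' h1 h2 => hu' l' ⟨h1, h2⟩⟩, hu' l ⟨hl, h⟩⟩

/-- The point `q` lies on no line of `R`. -/
def Off (R : Finset (ℝ × ℝ)) (q : ℝ × ℝ) : Prop := ∀ l ∈ R, q.2 ≠ ev l q.1

/-- No line of `R` crosses a line next to `q` over the half-open interval `(x, x']`. -/
def Clear (R : Finset (ℝ × ℝ)) (q : ℝ × ℝ) (x x' : ℝ) : Prop :=
  ∀ σ : ℝ, σ = 1 ∨ σ = -1 → ∀ u ∈ nb σ R q, ∀ w ∈ R, w ≠ u → ∀ X, x < X → X ≤ x' →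
    ev w X ≠ ev u X

/-- The points `q` and `q'` lie in the same trapezoid of the vertical decomposition of the
arrangement `R`. -/
def SameCell (R : Finset (ℝ × ℝ)) (q q' : ℝ × ℝ) : Prop :=
  Off R q ∧ Off R q' ∧ (∀ σ : ℝ, σ = 1 ∨ σ = -1 → nb σ R q = nb σ R q') ∧
    Clear R q (min q.1 q'.1) (max q.1 q'.1)

lemma Clear.congr {R : Finset (ℝ × ℝ)} {q q' : ℝ × ℝ} {x x' : ℝ}
    (h : ∀ σ : ℝ, σ = 1 ∨ σ = -1 → nb σ R q = nb σ R q') (hc : Clear R q x x') :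
    Clear R q' x x' := fun σ hσ u hu => hc σ hσ u (h σ hσ ▸ hu)

lemma SameCell.symm {R : Finset (ℝ × ℝ)} {q q' : ℝ × ℝ} (h : SameCell R q q') :
    SameCell R q' q :=
  ⟨h.2.1, h.1, fun σ hσ => (h.2.2.1 σ hσ).symm, by
    have := h.2.2.2.congr h.2.2.1
    rwa [min_comm, max_comm] at this⟩

lemma Off.side_iff {σ : ℝ} (hσ : σ ≠ 0) {R : Finset (ℝ × ℝ)} {q u w : ℝ × ℝ} (hq : Off R q)
    (hu : u ∈ nb σ R q) (hw : w ∈ R) :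
    -σ * q.2 < -σ * ev w q.1 ↔ germ σ q.1 w < germ σ q.1 u := by
  rw [mem_nb] at hu
  constructor
  · intro h
    exact germ_lt_iff.2 (Or.inl (by linarith [hu.2.1]))
  · intro h
    by_contra hc
    have hne : σ * q.2 ≠ σ * ev w q.1 := fun h => hq w hw (mul_left_cancel₀ hσ h)
    have : σ * q.2 < σ * ev w q.1 := lt_of_le_of_ne (by linarith) hne
    exact absurd (hu.2.2 w hw this) (not_le.2 h)

/-- By `Off.side_iff` the lines on the side `-σ` of either point are those whose germ precedes that
of `u`. None of them crosses `u` in between, so both points see the same lines on that side, and the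
nearest one at `q'`, being uncrossed too, is nearest at `q`. -/
lemma nb_opposite_eq {σ : ℝ} (hσ : σ = 1 ∨ σ = -1) {R : Finset (ℝ × ℝ)} {q q' u : ℝ × ℝ}
    (hq : Off R q) (hq' : Off R q') (hx : q.1 ≤ q'.1) (hc : Clear R q' q.1 q'.1)
    (hu : u ∈ nb σ R q) (hu' : u ∈ nb σ R q') : nb (-σ) R q = nb (-σ) R q' := by
  have h0 : σ ≠ 0 := by rcases hσ with rfl | rfl <;> norm_num
  have h0' : -σ ≠ 0 := neg_ne_zero.2 h0
  have hσ' : -σ = 1 ∨ -σ = -1 := by rcases hσ with rfl | rfl <;> norm_num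
  have side : ∀ w ∈ R, (-σ * q.2 < -σ * ev w q.1 ↔ -σ * q'.2 < -σ * ev w q'.1) := by
    intro w hw
    rw [hq.side_iff h0 hu hw, hq'.side_iff h0 hu' hw]
    by_cases hwu : w = u
    · simp [hwu]
    · exact germ_lt_germ_congr h0 hwu hx fun X h1 h2 => hc σ hσ u hu' w hw hwu X h1 h2
  have sub : ∀ d ∈ nb (-σ) R q', d ∈ nb (-σ) R q := by
    intro d hd
    have hd' := mem_nb.1 hd
    refine mem_nb.2 ⟨hd'.1, (side d hd'.1).2 hd'.2.1, fun w hw h => ?_⟩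
    by_cases hwd : w = d
    · rw [hwd]
    have h1 := hd'.2.2 w hw ((side w hw).1 h)
    rw [← not_lt] at h1 ⊢
    rwa [germ_lt_germ_congr h0' hwd hx fun X h1 h2 => hc (-σ) hσ' d hd w hw hwd X h1 h2]
  refine Finset.Subset.antisymm (fun d hd => ?_) sub
  have hd' := mem_nb.1 hd
  obtain ⟨e, he, -⟩ := exists_mem_nb hd'.1 ((side d hd'.1).1 hd'.2.1)
  rwa [nb_unique h0' hd (sub e he)]

lemma SameCell.of_shared {σ : ℝ} (hσ : σ = 1 ∨ σ = -1) {R : Finset (ℝ × ℝ)} {q q' u : ℝ × ℝ}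
    (hq : Off R q) (hq' : Off R q') (hx : q.1 ≤ q'.1) (hc : Clear R q' q.1 q'.1)
    (hu : u ∈ nb σ R q) (hu' : u ∈ nb σ R q') : SameCell R q q' := by
  have h0 : σ ≠ 0 := by rcases hσ with rfl | rfl <;> norm_num
  have h1 := nb_opposite_eq hσ hq hq' hx hc hu hu'
  have h2 : nb σ R q = nb σ R q' := by
    ext d
    constructor
    · intro hd; rwa [nb_unique h0 hd hu]
    · intro hd; rwa [nb_unique h0 hd hu']
  have h3 : ∀ τ : ℝ, τ = 1 ∨ τ = -1 → nb τ R q = nb τ R q' := by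
    rcases hσ with rfl | rfl <;> rintro τ (rfl | rfl) <;> simp_all
  refine ⟨hq, hq', h3, ?_⟩
  rw [min_eq_left hx, max_eq_right hx]
  exact hc.congr fun τ hτ => (h3 τ hτ).symm

/-- The label `k` describes the cell of `q` in the vertical decomposition of `R`. -/
def HasLabel (R : Finset (ℝ × ℝ)) (q : ℝ × ℝ) :
    (Bool × (ℝ × ℝ) × (ℝ × ℝ)) ⊕ (Finset (ℝ × ℝ) × Finset (ℝ × ℝ)) → Prop
  | .inl (s, u, w) => u ∈ nb (if s then 1 else -1) R q ∧ w ∈ R ∧ w ≠ u ∧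
      ∃ X ≤ q.1, ev w X = ev u X ∧ Clear R q X q.1
  | .inr (A, B) => nb 1 R q = A ∧ nb (-1) R q = B ∧ ∀ x, Clear R q x q.1

/-- The crossing of `u` and `w` fixes the abscissa of the left wall, and the clear interval of the
point further right reaches back to it, hence covers the other point. One shared neighbour then
suffices, by `SameCell.of_shared`. Cells without a left wall are told apart by both neighbours. -/
lemma HasLabel.sameCell {R : Finset (ℝ × ℝ)} {q q' : ℝ × ℝ} {k} (hq : Off R q) (hq' : Off R q')
    (h : HasLabel R q k) (h' : HasLabel R q' k) : SameCell R q q' := by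
  wlog hx : q.1 ≤ q'.1 generalizing q q'
  · exact (this hq' hq h' h (le_of_not_ge hx)).symm
  rcases k with ⟨s, u, w⟩ | ⟨A, B⟩
  · obtain ⟨hu, hw, hwu, X, hX, hX', hc⟩ := h
    obtain ⟨hu', -, -, Y, hY, hY', hc'⟩ := h'
    have hXY : X = Y := by
      have h1 : w.1 ≠ u.1 := fun h1 => hwu (Prod.ext h1 (by simpa [ev, h1] using hX'))
      simp only [ev] at hX' hY'
      have : (w.1 - u.1) * (X - Y) = 0 := by linear_combination hX' - hY'
      rcases mul_eq_zero.1 this with h | h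
      · exact absurd (sub_eq_zero.1 h) h1
      · exact sub_eq_zero.1 h
    subst hXY
    refine SameCell.of_shared (σ := if s then 1 else -1) (by cases s <;> simp) hq hq' hx ?_ hu hu'
    exact fun σ hσ u hu w hw hwu Z h1 h2 => hc' σ hσ u hu w hw hwu Z (hX.trans_lt h1) h2
  · obtain ⟨h1, h2, -⟩ := h
    obtain ⟨h1', h2', hc⟩ := h'
    have h3 : ∀ σ : ℝ, σ = 1 ∨ σ = -1 → nb σ R q = nb σ R q' := by
      rintro σ (rfl | rfl)
      · rw [h1, h1']
      · rw [h2, h2']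
    refine ⟨hq, hq', h3, ?_⟩
    rw [min_eq_left hx, max_eq_right hx]
    exact (hc q.1).congr fun τ hτ => (h3 τ hτ).symm

open Classical in
/-- The labels available for the cells of `R`. -/
noncomputable def labels (R : Finset (ℝ × ℝ)) :
    Finset ((Bool × (ℝ × ℝ) × (ℝ × ℝ)) ⊕ (Finset (ℝ × ℝ) × Finset (ℝ × ℝ))) :=
  ((Finset.univ : Finset Bool) ×ˢ (R ×ˢ R)).disjSum
    (insert ∅ (R.image singleton) ×ˢ insert ∅ (R.image singleton))

lemma card_labels_le {R : Finset (ℝ × ℝ)} {r : ℕ} (hR : R.card = r) (hr : 1 ≤ r) :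
    (labels R).card ≤ 6 * r ^ 2 := by
  classical
  have h : (insert ∅ (R.image singleton) : Finset (Finset (ℝ × ℝ))).card ≤ r + 1 :=
    (Finset.card_insert_le _ _).trans (by simpa [hR] using Finset.card_image_le (s := R))
  have h2 := Nat.mul_le_mul h h
  simp only [labels, Finset.card_disjSum, Finset.card_product, hR, Finset.card_univ,
    Fintype.card_bool]
  nlinarith

lemma nb_mem_subsingletons {σ : ℝ} (hσ : σ ≠ 0) (R : Finset (ℝ × ℝ)) (q : ℝ × ℝ) :
    open Classical in nb σ R q ∈ insert ∅ (R.image singleton) := by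
  classical
  rcases (nb σ R q).eq_empty_or_nonempty with h | ⟨u, hu⟩
  · simp [h]
  · refine Finset.mem_insert_of_mem (Finset.mem_image.2 ⟨u, (mem_nb.1 hu).1, ?_⟩)
    ext d
    rw [Finset.mem_singleton]
    exact ⟨fun h => h ▸ hu, fun h => nb_unique hσ h hu⟩

/-- The left wall is the rightmost crossing, not to the right of `q`, of a neighbour of `q` with
another line; if there is none, the cell is unbounded to the left. -/
lemma exists_label (R : Finset (ℝ × ℝ)) (q : ℝ × ℝ) : ∃ k ∈ labels R, HasLabel R q k := by
  classical
  let cr : (ℝ × ℝ) × (ℝ × ℝ) → ℝ := fun z => -(z.2.2 - z.1.2) / (z.2.1 - z.1.1)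
  have hcr : ∀ u w : ℝ × ℝ, w ≠ u → ∀ X, ev w X = ev u X → X = cr (u, w) := by
    intro u w hwu X hX
    have h1 : w.1 ≠ u.1 := fun h1 => hwu (Prod.ext h1 (by simpa [ev, h1] using hX))
    have h2 : w.1 - u.1 ≠ 0 := sub_ne_zero.2 h1
    simp only [ev] at hX
    simp only [cr]
    field_simp
    linear_combination hX
  let S := ((Finset.univ : Finset Bool) ×ˢ (R ×ˢ R)).filter fun z =>
    z.2.1 ∈ nb (if z.1 then 1 else -1) R q ∧ z.2.2 ≠ z.2.1 ∧ cr z.2 ≤ q.1 ∧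
      ev z.2.2 (cr z.2) = ev z.2.1 (cr z.2)
  have hS : ∀ σ : ℝ, σ = 1 ∨ σ = -1 → ∀ u ∈ nb σ R q, ∀ w ∈ R, w ≠ u → ∀ X ≤ q.1,
      ev w X = ev u X → ∃ s, (s, u, w) ∈ S ∧ X = cr (u, w) := by
    intro σ hσ u hu w hw hwu X hX hX'
    have hX'' := hcr u w hwu X hX'
    have huR := (mem_nb.1 hu).1
    rw [hX''] at hX hX'
    rcases hσ with rfl | rfl
    · exact ⟨true, by simp [S, hu, hw, hwu, huR, hX, hX'], hX''⟩
    · exact ⟨false, by simp [S, hu, hw, hwu, huR, hX, hX'], hX''⟩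
  rcases S.eq_empty_or_nonempty with hE | hne
  · refine ⟨.inr (nb 1 R q, nb (-1) R q), ?_, rfl, rfl, ?_⟩
    · simp only [labels, Finset.inr_mem_disjSum, Finset.mem_product]
      exact ⟨nb_mem_subsingletons one_ne_zero R q, nb_mem_subsingletons (by norm_num) R q⟩
    · intro x σ hσ u hu w hw hwu X _ hX hX'
      obtain ⟨s, hs, -⟩ := hS σ hσ u hu w hw hwu X hX hX'
      simp [hE] at hs
  · obtain ⟨⟨s, u, w⟩, hz, hmax⟩ := Finset.exists_max_image S (fun z => cr z.2) hne
    simp only [S, Finset.mem_filter, Finset.mem_product, Finset.mem_univ, true_and] at hz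
    obtain ⟨⟨huR, hwR⟩, hu, hwu, hle, heq⟩ := hz
    refine ⟨.inl (s, u, w), by simp [labels, huR, hwR], hu, hwR, hwu, cr (u, w), hle, heq, ?_⟩
    intro σ hσ u' hu' w' hw' hwu' X hX1 hX2 hX'
    obtain ⟨s', hs', hX''⟩ := hS σ hσ u' hu' w' hw' hwu' X hX2 hX'
    have := hmax _ hs'
    simp only at this
    linarith

/-! ### Lines that define a cell. -/

/-- The line `l` is the one of `R` whose crossing with the line next to `q` on side `σ` is the
last one before `q` (`left`), respectively the first one after `q`. -/
def IsWall (left : Bool) (σ : ℝ) (R : Finset (ℝ × ℝ)) (q l : ℝ × ℝ) : Prop :=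
  ∃ u ∈ nb σ R q, l ≠ u ∧ ∃ X, (if left then X ≤ q.1 else q.1 < X) ∧ ev l X = ev u X ∧
    ∀ w ∈ R, w ≠ u → w ≠ l → ∀ Y, (if left then Y ≤ q.1 else q.1 < Y) → ev w Y = ev u Y →
      if left then Y < X else X < Y

lemma IsWall.unique {left : Bool} {σ : ℝ} (hσ : σ ≠ 0) {R : Finset (ℝ × ℝ)} {q l l' : ℝ × ℝ}
    (hl : l ∈ R) (hl' : l' ∈ R) (h : IsWall left σ R q l) (h' : IsWall left σ R q l') :
    l = l' := by
  obtain ⟨u, hu, hlu, X, hX, hX', hm⟩ := h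
  obtain ⟨u', hu', hlu', Y, hY, hY', hm'⟩ := h'
  obtain rfl := nb_unique hσ hu hu'
  by_contra hne
  have h1 := hm l' hl' hlu' (Ne.symm hne) Y hY hY'
  have h2 := hm' l hl hlu hne X hX hX'
  cases left <;> simp at h1 h2 <;> linarith

/-- If the line `l` of `R` meets the cell that contains `q` once `l` is removed, then `l` passes
through `q`, is next to `q`, or is a wall of the cell of `q`. -/
lemma SameCell.cases_of_erase [DecidableEq (ℝ × ℝ)] {R : Finset (ℝ × ℝ)} {q q' l : ℝ × ℝ}
    (hl : l ∈ R) (h : SameCell (R.erase l) q q') (hq' : q'.2 = ev l q'.1) :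
    q.2 = ev l q.1 ∨ ∃ σ : ℝ, (σ = 1 ∨ σ = -1) ∧
      (l ∈ nb σ R q ∨ IsWall true σ R q l ∨ IsWall false σ R q l) := by
  by_cases hlq : q.2 = ev l q.1
  · exact Or.inl hlq
  right
  obtain ⟨σ, hσ, hs⟩ : ∃ σ : ℝ, (σ = 1 ∨ σ = -1) ∧ σ * q.2 < σ * ev l q.1 := by
    rcases lt_or_gt_of_ne hlq with h | h
    · exact ⟨1, Or.inl rfl, by linarith⟩
    · exact ⟨-1, Or.inr rfl, by linarith⟩
  have h0 : σ ≠ 0 := by rcases hσ with rfl | rfl <;> norm_num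
  refine ⟨σ, hσ, ?_⟩
  by_cases hmin : l ∈ nb σ R q
  · exact Or.inl hmin
  right
  rw [mem_nb] at hmin
  push Not at hmin
  obtain ⟨v, hvR, hv, hvl⟩ := hmin hl hs
  have hvl' : v ≠ l := by rintro rfl; exact lt_irrefl _ hvl
  obtain ⟨u, hu, huv⟩ := exists_mem_nb (R := R.erase l) (Finset.mem_erase.2 ⟨hvl', hvR⟩) hv
  have hul := huv.trans_lt hvl
  have hu1 := mem_nb.1 hu
  have huR : u ∈ nb σ R q := by
    refine mem_nb.2 ⟨Finset.mem_of_mem_erase hu1.1, hu1.2.1, fun w hw hwq => ?_⟩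
    by_cases hwl : w = l
    · rw [hwl]; exact hul.le
    · exact hu1.2.2 w (Finset.mem_erase.2 ⟨hwl, hw⟩) hwq
  have hlu : l ≠ u := by rintro rfl; exact lt_irrefl _ hul
  have hu' : u ∈ nb σ (R.erase l) q' := h.2.2.1 σ hσ ▸ hu
  have hlt : σ * ev l q'.1 < σ * ev u q'.1 := hq' ▸ (mem_nb.1 hu').2.1
  -- At `q` the line `l` lies beyond `u`; at `q'`, which is on `l`, it lies before `u`. So the two
  -- cross in between, where no other line crosses `u`, which makes `l` a wall.
  rcases lt_trichotomy q.1 q'.1 with hx | hx | hx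
  · right
    obtain ⟨X, h1, h2, h3⟩ := exists_crossing_right h0 hul hx hlt.le
    refine ⟨u, huR, hlu, X, by simpa using h1, h3.symm, fun w hw hwu hwl Y hY hY' => ?_⟩
    simp only [Bool.false_eq_true, if_false] at hY ⊢
    by_contra hc
    refine h.2.2.2 σ hσ u hu w (Finset.mem_erase.2 ⟨hwl, hw⟩) hwu Y ?_ ?_ hY'
    · rwa [min_eq_left hx.le]
    · rw [max_eq_right hx.le]; linarith
  · rw [← hx] at hlt
    exact absurd (germ_lt_iff.2 (Or.inl hlt)) hul.asymm
  · left
    obtain ⟨X, h1, h2, h3⟩ := exists_crossing_left h0 hul hx hlt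
    refine ⟨u, huR, hlu, X, by simpa using h2, h3.symm, fun w hw hwu hwl Y hY hY' => ?_⟩
    simp only [if_true] at hY ⊢
    by_contra hc
    refine h.2.2.2 σ hσ u hu w (Finset.mem_erase.2 ⟨hwl, hw⟩) hwu Y ?_ ?_ hY'
    · rw [min_eq_right hx.le]; linarith
    · rwa [max_eq_left hx.le]

open Classical in
/-- A cell of the vertical decomposition is determined by at most seven lines. -/
lemma card_defining_le (Q R : Finset (ℝ × ℝ)) (q : ℝ × ℝ) :
    (R.filter fun l => ∃ q' ∈ Q, SameCell (R.erase l) q q' ∧ q'.2 = ev l q'.1).card ≤ 7 := by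
  have hsub : (R.filter fun l => ∃ q' ∈ Q, SameCell (R.erase l) q q' ∧ q'.2 = ev l q'.1) ⊆
      (R.filter fun l => q.2 = ev l q.1 ∧ Off (R.erase l) q) ∪
      (nb 1 R q ∪ nb (-1) R q ∪
        ((R.filter (IsWall true 1 R q)) ∪ (R.filter (IsWall true (-1) R q))) ∪
        ((R.filter (IsWall false 1 R q)) ∪ (R.filter (IsWall false (-1) R q)))) := by
    intro l hl
    simp only [Finset.mem_filter] at hl
    obtain ⟨hl, q', -, hsc, hon⟩ := hl
    simp only [Finset.mem_union, Finset.mem_filter]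
    rcases hsc.cases_of_erase hl hon with h | ⟨σ, rfl | rfl, h | h | h⟩
    · exact Or.inl ⟨hl, h, hsc.1⟩
    all_goals tauto
  have h1 : (1 : ℝ) ≠ 0 := one_ne_zero
  have h2 : (-1 : ℝ) ≠ 0 := by norm_num
  have hon : (R.filter fun l => q.2 = ev l q.1 ∧ Off (R.erase l) q).card ≤ 1 := by
    refine Finset.card_le_one.2 fun a ha b hb => ?_
    simp only [Finset.mem_filter] at ha hb
    by_contra hne
    exact ha.2.2 b (Finset.mem_erase.2 ⟨Ne.symm hne, hb.1⟩) hb.2.1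
  have hnb : ∀ σ : ℝ, σ ≠ 0 → (nb σ R q).card ≤ 1 := fun σ hσ =>
    Finset.card_le_one.2 fun a ha b hb => nb_unique hσ ha hb
  have hw : ∀ (s : Bool) (σ : ℝ), σ ≠ 0 → (R.filter (IsWall s σ R q)).card ≤ 1 := fun s σ hσ =>
    Finset.card_le_one.2 fun a ha b hb => by
      simp only [Finset.mem_filter] at ha hb
      exact ha.2.unique hσ ha.1 hb.1 hb.2
  -- Seven is one line through `q`, two neighbours and four walls.
  refine (Finset.card_le_card hsub).trans ?_
  refine (Finset.card_union_le _ _).trans ?_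
  have e1 := Finset.card_union_le (nb 1 R q) (nb (-1) R q)
  have e2 := Finset.card_union_le (R.filter (IsWall true 1 R q)) (R.filter (IsWall true (-1) R q))
  have e3 := Finset.card_union_le (R.filter (IsWall false 1 R q))
    (R.filter (IsWall false (-1) R q))
  have e4 := Finset.card_union_le (nb 1 R q ∪ nb (-1) R q)
    ((R.filter (IsWall true 1 R q)) ∪ (R.filter (IsWall true (-1) R q)))
  have e5 := Finset.card_union_le (nb 1 R q ∪ nb (-1) R q ∪
    ((R.filter (IsWall true 1 R q)) ∪ (R.filter (IsWall true (-1) R q))))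
    ((R.filter (IsWall false 1 R q)) ∪ (R.filter (IsWall false (-1) R q)))
  have := hnb 1 h1
  have := hnb (-1) h2
  have := hw true 1 h1
  have := hw true (-1) h2
  have := hw false 1 h1
  have := hw false (-1) h2
  omega

/-! ### Elementary incidence bounds. -/

/-- The number of incidences between the points `Q` and the lines `Λ`. -/
noncomputable def inc (Q Λ : Finset (ℝ × ℝ)) : ℕ :=
  open Classical in ∑ l ∈ Λ, (Q.filter fun q => q.2 = ev l q.1).card

/-- The lines of `Λ` that contain a point of `g`. -/
noncomputable def touching (Λ g : Finset (ℝ × ℝ)) : Finset (ℝ × ℝ) :=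
  open Classical in Λ.filter fun l => ∃ q ∈ g, q.2 = ev l q.1

lemma line_unique {q q' l l' : ℝ × ℝ} (hne : q ≠ q') (h1 : q.2 = ev l q.1) (h2 : q'.2 = ev l q'.1)
    (h3 : q.2 = ev l' q.1) (h4 : q'.2 = ev l' q'.1) : l = l' := by
  simp only [ev] at *
  have hx : q.1 - q'.1 ≠ 0 := by
    intro h
    have h := sub_eq_zero.1 h
    exact hne (Prod.ext h (by rw [h1, h2, h]))
  have h5 : (q.1 - q'.1) * (l.1 - l'.1) = 0 := by linear_combination -h1 + h2 + h3 - h4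
  have h6 : l.1 = l'.1 := sub_eq_zero.1 ((mul_eq_zero.1 h5).resolve_left hx)
  exact Prod.ext h6 (by rw [h6] at h1; linarith)

lemma point_fst_ne {q q' l : ℝ × ℝ} (hne : q ≠ q') (h1 : q.2 = ev l q.1) (h2 : q'.2 = ev l q'.1) :
    q.1 ≠ q'.1 := fun h => hne (Prod.ext h (by rw [h1, h2, h]))

/-- Cauchy–Schwarz over the lines, together with the fact that an ordered pair of distinct points
lies on at most one line. -/
lemma inc_sq_le (Q Λ : Finset (ℝ × ℝ)) :
    inc Q Λ ^ 2 ≤ Λ.card * (Q.card ^ 2 + inc Q Λ) := by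
  classical
  have h1 : inc Q Λ ^ 2 ≤ Λ.card * ∑ l ∈ Λ, (Q.filter fun q => q.2 = ev l q.1).card ^ 2 :=
    sq_sum_le_card_mul_sum_sq
  refine h1.trans (Nat.mul_le_mul_left _ ?_)
  have h2 : ∀ l, (Q.filter fun q => q.2 = ev l q.1).card ^ 2 =
      (Q.filter fun q => q.2 = ev l q.1).offDiag.card +
        (Q.filter fun q => q.2 = ev l q.1).card := by
    intro l
    rw [Finset.offDiag_card, sq]
    have := Nat.le_mul_self (Q.filter fun q => q.2 = ev l q.1).card
    omega
  simp_rw [h2, Finset.sum_add_distrib]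
  refine Nat.add_le_add ?_ le_rfl
  rw [← Finset.card_biUnion]
  · rw [sq, ← Finset.card_product]
    refine Finset.card_le_card fun z hz => ?_
    simp only [Finset.mem_biUnion, Finset.mem_offDiag, Finset.mem_filter] at hz
    obtain ⟨l, -, h, h', -⟩ := hz
    exact Finset.mem_product.2 ⟨h.1, h'.1⟩
  · intro l _ l' _ hne
    refine Finset.disjoint_left.2 fun z hz hz' => hne ?_
    simp only [Finset.mem_offDiag, Finset.mem_filter] at hz hz'
    exact line_unique hz.2.2 hz.1.2 hz.2.1.2 hz'.1.2 hz'.2.1.2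

lemma inc_le (Q Λ : Finset (ℝ × ℝ)) :
    (inc Q Λ : ℝ) ≤ Λ.card + Q.card * √(Λ.card) := by
  have h : ((inc Q Λ : ℝ)) ^ 2 ≤ Λ.card * ((Q.card : ℝ) ^ 2 + inc Q Λ) := by
    exact_mod_cast inc_sq_le Q Λ
  by_contra hc
  push Not at hc
  have hn : (0 : ℝ) ≤ Λ.card := Nat.cast_nonneg _
  have h0 : 0 ≤ (Q.card : ℝ) * √(Λ.card) := by positivity
  have h1 : (Q.card : ℝ) * √(Λ.card) < inc Q Λ - Λ.card := by linarith
  have h2 : (Q.card : ℝ) * √(Λ.card) < inc Q Λ := by linarith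
  have h3 := mul_lt_mul'' h1 h2 h0 h0
  have h4 : (Q.card : ℝ) * √(Λ.card) * (Q.card * √(Λ.card)) = Q.card ^ 2 * Λ.card := by
    rw [mul_mul_mul_comm, Real.mul_self_sqrt hn, sq]
  nlinarith

/-! ### Random sampling and groups met by few lines. -/

open Classical in
/-- The lines of `Λ` that meet the cell of `q` in the vertical decomposition of `R`. -/
noncomputable def conflict (Q Λ R : Finset (ℝ × ℝ)) (q : ℝ × ℝ) : Finset (ℝ × ℝ) :=
  Λ.filter fun l => ∃ q' ∈ Q, SameCell R q q' ∧ q'.2 = ev l q'.1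

/-- Clarkson–Shor backward counting: adding a conflicting line to the sample gives a set of `r + 1`
lines with a marked line whose removal lets it meet the cell of `q`. Each such set has at most seven
candidates for the mark. -/
lemma sum_card_conflict_le (Q Λ : Finset (ℝ × ℝ)) (q : ℝ × ℝ) (r : ℕ) :
    ∑ R ∈ Λ.powersetCard r, (conflict Q Λ R q).card ≤ 7 * Λ.card.choose (r + 1) := by
  classical
  have h7 : ∑ R ∈ Λ.powersetCard (r + 1),
      (R.filter fun l => ∃ q' ∈ Q, SameCell (R.erase l) q q' ∧ q'.2 = ev l q'.1).card
        ≤ 7 * Λ.card.choose (r + 1) := by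
    refine (Finset.sum_le_card_nsmul _ _ 7 fun R _ => card_defining_le Q R q).trans ?_
    simp [Finset.card_powersetCard, mul_comm]
  refine le_trans ?_ h7
  rw [← Finset.card_sigma, ← Finset.card_sigma]
  have hnot : ∀ R : Finset (ℝ × ℝ), ∀ l ∈ conflict Q Λ R q, l ∉ R := by
    intro R l hl hlR
    simp only [conflict, Finset.mem_filter] at hl
    obtain ⟨-, q', -, hsc, hon⟩ := hl
    exact hsc.2.1 l hlR hon
  refine Finset.card_le_card_of_injOn (fun z => ⟨insert z.2 z.1, z.2⟩) ?_ ?_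
  · rintro ⟨R, l⟩ hz
    simp only [Finset.coe_sigma, Set.mem_sigma_iff, Finset.mem_coe,
      Finset.mem_powersetCard] at hz
    have hlR := hnot R l hz.2
    have hl := hz.2
    simp only [conflict, Finset.mem_filter] at hl
    simp only [Finset.coe_sigma, Set.mem_sigma_iff, Finset.mem_coe, Finset.mem_powersetCard,
      Finset.mem_filter, Finset.erase_insert hlR]
    exact ⟨⟨Finset.insert_subset hl.1 hz.1.1, by rw [Finset.card_insert_of_notMem hlR, hz.1.2]⟩,
      Finset.mem_insert_self _ _, hl.2⟩
  · rintro ⟨R, l⟩ hz ⟨R', l'⟩ hz' heq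
    simp only [Finset.coe_sigma, Set.mem_sigma_iff, Finset.mem_coe] at hz hz'
    have hlR := hnot R l hz.2
    have hlR' := hnot R' l' hz'.2
    simp only [Sigma.mk.injEq, heq_eq_eq] at heq
    obtain ⟨h1, rfl⟩ := heq
    have : R = R' := by rw [← Finset.erase_insert hlR, h1, Finset.erase_insert hlR']
    rw [this]

open Classical in
lemma card_not_off_le (Λ : Finset (ℝ × ℝ)) (q : ℝ × ℝ) (r : ℕ) :
    Λ.card * ((Λ.powersetCard r).filter fun R => ¬ Off R q).card ≤
      (Λ.filter fun l => q.2 = ev l q.1).card * (r * Λ.card.choose r) := by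
  rcases r with _ | r
  · have : ((Λ.powersetCard 0).filter fun R => ¬ Off R q) = ∅ := by
      ext R; simp [Off]; rintro rfl; simp
    rw [this]; simp
  have hsub : ((Λ.powersetCard (r + 1)).filter fun R => ¬ Off R q) ⊆
      (Λ.filter fun l => q.2 = ev l q.1).biUnion fun l =>
        (Λ.erase l).powersetCard r |>.image (insert l) := by
    intro R hR
    obtain ⟨hR, hoff⟩ := Finset.mem_filter.1 hR
    obtain ⟨hR, hc⟩ := Finset.mem_powersetCard.1 hR
    unfold Off at hoff
    push Not at hoff
    obtain ⟨l, hl, hon⟩ := hoff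
    simp only [Finset.mem_biUnion, Finset.mem_filter, Finset.mem_image, Finset.mem_powersetCard]
    exact ⟨l, ⟨hR hl, hon⟩, R.erase l, ⟨Finset.erase_subset_erase l hR, by
      rw [Finset.card_erase_of_mem hl, hc]; rfl⟩, Finset.insert_erase hl⟩
  have h1 : ((Λ.powersetCard (r + 1)).filter fun R => ¬ Off R q).card ≤
      (Λ.filter fun l => q.2 = ev l q.1).card * (Λ.card - 1).choose r := by
    refine (Finset.card_le_card hsub).trans (Finset.card_biUnion_le_card_mul _ _ _ fun l hl => ?_)
    refine Finset.card_image_le.trans ?_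
    rw [Finset.card_powersetCard, Finset.card_erase_of_mem (Finset.mem_filter.1 hl).1]
  refine (Nat.mul_le_mul_left _ h1).trans ?_
  rcases Nat.eq_zero_or_pos Λ.card with h0 | h0
  · simp [h0]
  obtain ⟨k, hk⟩ := Nat.exists_eq_succ_of_ne_zero h0.ne'
  rw [hk]
  have := Nat.add_one_mul_choose_eq k r
  simp only [Nat.succ_eq_add_one, Nat.add_sub_cancel]
  calc (k + 1) * ((Λ.filter fun l => q.2 = ev l q.1).card * k.choose r)
      = (Λ.filter fun l => q.2 = ev l q.1).card * ((k + 1) * k.choose r) := by ring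
    _ = _ := by rw [this]; ring
    _ ≤ _ := le_rfl

lemma sum_degree_eq_inc (Q Λ : Finset (ℝ × ℝ)) :
    open Classical in ∑ q ∈ Q, (Λ.filter fun l => q.2 = ev l q.1).card = inc Q Λ := by
  classical
  unfold inc
  exact Finset.sum_card_bipartiteAbove_eq_sum_card_bipartiteBelow 
    (fun (q l : ℝ × ℝ) => q.2 = ev l q.1)

/-- Some sample `R` of `r` lines has small conflicts on average, points on `R` being charged
`100 * n / r`. -/
lemma exists_good_sample (Q Λ : Finset (ℝ × ℝ)) {r : ℕ} (hr : 1 ≤ r)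
    (hm : 400 * r ≤ Q.card) (hn : 160000 * r ^ 2 ≤ Λ.card) :
    open Classical in ∃ R ∈ Λ.powersetCard r,
      ∑ q ∈ Q, (((conflict Q Λ R q).card : ℝ) + if Off R q then (0 : ℝ) else 100 * Λ.card / r) ≤
        Q.card * (15 / 2 * (Λ.card / r)) := by
  classical
  have hrn : r ≤ Λ.card := by nlinarith
  have hne : (Λ.powersetCard r).Nonempty := Finset.powersetCard_nonempty.2 hrn
  set n : ℝ := (Λ.card : ℝ) with hn_def
  set m : ℝ := (Q.card : ℝ) with hm_def
  set c : ℝ := (Λ.card.choose r : ℝ) with hc_def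
  have hr0 : (0 : ℝ) < r := by exact_mod_cast hr
  have hr1 : (1 : ℝ) ≤ r := by exact_mod_cast hr
  have hmR : 400 * (r : ℝ) ≤ m := by rw [hm_def]; exact_mod_cast hm
  have hnR : 160000 * (r : ℝ) ^ 2 ≤ n := by rw [hn_def]; exact_mod_cast hn
  have hn0 : 0 < n := by nlinarith
  have hc0 : 0 < c := by rw [hc_def]; exact_mod_cast Nat.choose_pos hrn
  have hA : ∀ q ∈ Q, ∑ R ∈ Λ.powersetCard r, ((conflict Q Λ R q).card : ℝ) ≤ 7 * (n / r) * c := by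
    intro q _
    have h1 : (∑ R ∈ Λ.powersetCard r, ((conflict Q Λ R q).card : ℝ)) ≤
        7 * (Λ.card.choose (r + 1) : ℝ) := by exact_mod_cast sum_card_conflict_le Q Λ q r
    have h2 : (Λ.card.choose (r + 1) : ℝ) * (r + 1) = c * (n - r) := by
      have := Nat.choose_succ_right_eq Λ.card r
      have h3 : ((Λ.card.choose (r + 1) * (r + 1) : ℕ) : ℝ) =
        ((Λ.card.choose r * (Λ.card - r) : ℕ) : ℝ) := by rw [this]
      push_cast [Nat.cast_sub hrn] at h3
      exact h3
    have h4 : (Λ.card.choose (r + 1) : ℝ) ≤ n / r * c := by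
      rw [div_mul_eq_mul_div, le_div_iff₀ hr0]
      have : (0 : ℝ) ≤ Λ.card.choose (r + 1) := Nat.cast_nonneg _
      nlinarith
    nlinarith
  have hB : ∀ q ∈ Q, ∑ R ∈ Λ.powersetCard r, (if Off R q then (0 : ℝ) else 100 * n / r) ≤
      100 * c * ((Λ.filter fun l => q.2 = ev l q.1).card : ℝ) := by
    intro q _
    have h1 : ∑ R ∈ Λ.powersetCard r, (if Off R q then (0 : ℝ) else 100 * n / r) =
        (((Λ.powersetCard r).filter fun R => ¬ Off R q).card : ℝ) * (100 * n / r) := by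
      rw [← nsmul_eq_mul, ← Finset.sum_const, Finset.sum_filter]
      refine Finset.sum_congr rfl fun R _ => ?_
      by_cases h : Off R q <;> simp [h]
    have h2 : n * (((Λ.powersetCard r).filter fun R => ¬ Off R q).card : ℝ) ≤
        ((Λ.filter fun l => q.2 = ev l q.1).card : ℝ) * (r * c) := by
      rw [hn_def, hc_def]
      exact_mod_cast card_not_off_le Λ q r
    rw [h1, mul_div_assoc', div_le_iff₀ hr0]
    nlinarith
  have hsum : ∑ R ∈ Λ.powersetCard r, ∑ q ∈ Q,
      (((conflict Q Λ R q).card : ℝ) + if Off R q then 0 else 100 * n / r) ≤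
      ∑ R ∈ Λ.powersetCard r, m * (15 / 2 * (n / r)) := by
    rw [Finset.sum_comm, Finset.sum_const, Finset.card_powersetCard, nsmul_eq_mul]
    calc _ ≤ ∑ q ∈ Q, (7 * (n / r) * c +
          100 * c * ((Λ.filter fun l => q.2 = ev l q.1).card : ℝ)) := by
          refine Finset.sum_le_sum fun q hq => ?_
          rw [Finset.sum_add_distrib]
          exact add_le_add (hA q hq) (hB q hq)
      _ = m * (7 * (n / r) * c) + 100 * c * inc Q Λ := by
          rw [Finset.sum_add_distrib, Finset.sum_const, nsmul_eq_mul, ← Finset.mul_sum,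
            ← sum_degree_eq_inc]
          push_cast
          rfl
      _ ≤ m * (7 * (n / r) * c) + 100 * c * (n + m * √n) := by
          gcongr
          exact inc_le Q Λ
      -- The hypotheses on `m` and `n` make `n` and `m * √n` each at most `m * (n / r) / 400`, so
      -- the charges add 100 · 2/400 = 1/2 to the 7 from the conflicts.
      _ ≤ c * (m * (15 / 2 * (n / r))) := by
          have hsq : √n * √n = n := Real.mul_self_sqrt hn0.le
          have h1 : 400 * (r : ℝ) ≤ √n := Real.le_sqrt_of_sq_le (by nlinarith)
          have hm0 : 0 < m := by linarith
          have h2 : √n ≤ n / r / 400 := by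
            rw [div_div, le_div_iff₀ (by positivity)]
            nlinarith [Real.sqrt_nonneg n]
          have h3 : n ≤ m * (n / r) / 400 := by
            rw [mul_div_assoc', div_div, le_div_iff₀ (by positivity)]
            nlinarith
          have h4 : m * √n ≤ m * (n / r / 400) := by gcongr
          nlinarith
  obtain ⟨R, hR, h⟩ := Finset.exists_le_of_sum_le hne hsum
  exact ⟨R, hR, h⟩

/-- Some `N` of the points are contained in few lines altogether. -/
lemma exists_group_of_sample (Q Λ : Finset (ℝ × ℝ)) {r N : ℕ} (hr : 1 ≤ r) (hN : 1 ≤ N)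
    (hm : 400 * r ≤ Q.card) (hn : 160000 * r ^ 2 ≤ Λ.card) (hN' : 12 * r ^ 2 * N ≤ Q.card) :
    ∃ g ⊆ Q, g.card = N ∧ ((touching Λ g).card : ℝ) ≤ 15 * (Λ.card / r) := by
  classical
  obtain ⟨R, hR, hsum⟩ := exists_good_sample Q Λ hr hm hn
  set w : ℝ × ℝ → ℝ := fun q =>
    ((conflict Q Λ R q).card : ℝ) + if Off R q then (0 : ℝ) else 100 * Λ.card / r with hw
  have hr0 : (0 : ℝ) < r := by exact_mod_cast hr
  have hn0 : (0 : ℝ) < Λ.card := by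
    have : 0 < Λ.card := by nlinarith
    exact_mod_cast this
  set T : ℝ := Λ.card / r with hT
  have hT0 : 0 < T := by positivity
  have hw0 : ∀ q, 0 ≤ w q := by
    intro q
    simp only [hw]
    split_ifs <;> positivity
  set G := Q.filter fun q => w q ≤ 15 * T with hG
  -- Markov: 15 is twice the average 15/2.
  have hGc : Q.card ≤ 2 * G.card := by
    have h1 : ((Q.filter fun q => ¬ w q ≤ 15 * T).card : ℝ) * (15 * T) ≤
        Q.card * (15 / 2 * T) := by
      rw [← nsmul_eq_mul, ← Finset.sum_const]
      calc _ ≤ ∑ q ∈ Q.filter (fun q => ¬ w q ≤ 15 * T), w q :=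
            Finset.sum_le_sum fun q hq => (not_le.1 (Finset.mem_filter.1 hq).2).le
        _ ≤ ∑ q ∈ Q, w q := Finset.sum_le_sum_of_subset_of_nonneg (Finset.filter_subset _ _)
            fun q _ _ => hw0 q
        _ ≤ _ := hsum
    have h2 : 2 * ((Q.filter fun q => ¬ w q ≤ 15 * T).card : ℝ) ≤ Q.card := by
      by_contra hc
      have hc := not_le.1 hc
      nlinarith
    have h3 : 2 * (Q.filter fun q => ¬ w q ≤ 15 * T).card ≤ Q.card := by exact_mod_cast h2
    have h4 := Finset.card_filter_add_card_filter_not (s := Q) (fun q => w q ≤ 15 * T)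
    rw [← hG] at h4
    omega
  -- A point on the sample is charged 100, more than the threshold 15.
  have hoff : ∀ q ∈ G, Off R q := by
    intro q hq
    by_contra hc
    have h1 := (Finset.mem_filter.1 hq).2
    simp only [hw, hc, if_false] at h1
    have : (0 : ℝ) ≤ (conflict Q Λ R q).card := Nat.cast_nonneg _
    have h2 : 100 * (Λ.card : ℝ) / r = 100 * T := by rw [hT]; ring
    rw [h2] at h1
    linarith
  choose k hk hlab using exists_label R
  have hRc : R.card = r := (Finset.mem_powersetCard.1 hR).2
  have hlabc := card_labels_le hRc hr
  obtain ⟨y, -, hy⟩ := Finset.exists_le_card_fiber_of_mul_le_card_of_maps_to (s := G)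
    (t := labels R) (f := k) (n := N) (fun q _ => hk q) ⟨_, hk 0⟩ (by
      have := Nat.mul_le_mul_right N hlabc
      nlinarith)
  obtain ⟨g, hg, hgc⟩ := Finset.exists_subset_card_eq hy
  have hgG : ∀ q ∈ g, q ∈ G ∧ k q = y := fun q hq => Finset.mem_filter.1 (hg hq)
  have hgQ : g ⊆ Q := fun q hq => Finset.filter_subset _ _ (hgG q hq).1
  refine ⟨g, hgQ, hgc, ?_⟩
  obtain ⟨q, hq⟩ : g.Nonempty := Finset.card_pos.1 (by omega)
  have hsub : touching Λ g ⊆ conflict Q Λ R q := by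
    intro l hl
    simp only [touching, conflict, Finset.mem_filter] at hl ⊢
    obtain ⟨hl, q', hq', hon⟩ := hl
    refine ⟨hl, q', hgQ hq', ?_, hon⟩
    have h1 := hlab q
    have h2 := hlab q'
    rw [(hgG q hq).2] at h1
    rw [(hgG q' hq').2] at h2
    exact HasLabel.sameCell (hoff q (hgG q hq).1) (hoff q' (hgG q' hq').1) h1 h2
  have h1 := (Finset.mem_filter.1 (hgG q hq).1).2
  have h2 : ((conflict Q Λ R q).card : ℝ) ≤ w q := by
    simp only [hw]
    split_ifs
    · simp
    · have : 0 ≤ 100 * (Λ.card : ℝ) / r := by positivity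
      linarith
  calc ((touching Λ g).card : ℝ) ≤ (conflict Q Λ R q).card := by
        exact_mod_cast Finset.card_le_card hsub
    _ ≤ _ := h2.trans h1

lemma exists_group (Q Λ : Finset (ℝ × ℝ)) {N : ℕ} (hN : 1 ≤ N) (hm : 160000 * N ≤ Q.card)
    (hn : Q.card ≤ Λ.card) :
    ∃ g ⊆ Q, g.card = N ∧ ((touching Λ g).card : ℝ) * √(Q.card) ≤ 12000 * Λ.card * √N := by
  -- Nearly the largest sample size that the previous lemma allows, up to a constant; then √|Q| <
  -- 400(r + 1)√N ≤ 800r√N, and 12000 = 15 · 800.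
  set r := Nat.sqrt (Q.card / (160000 * N)) with hr_def
  have hpos : 0 < 160000 * N := by omega
  have hr : 1 ≤ r := by
    rw [hr_def, Nat.le_sqrt]
    exact (Nat.one_le_div_iff hpos).2 hm
  have h1 : r * r * (160000 * N) ≤ Q.card :=
    (Nat.mul_le_mul_right _ (Nat.sqrt_le _)).trans (Nat.div_mul_le_self _ _)
  have h2 : Q.card < (160000 * N) * ((r + 1) * (r + 1)) := by
    have h3 : Q.card / (160000 * N) < (r + 1) * (r + 1) := Nat.lt_succ_sqrt _
    have := (Nat.div_lt_iff_lt_mul hpos).1 h3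
    rwa [mul_comm] at this
  have h3 : 160000 * r ^ 2 ≤ Q.card := by nlinarith [Nat.mul_le_mul_left (160000 * (r * r)) hN]
  obtain ⟨g, hg, hgc, ht⟩ := exists_group_of_sample Q Λ hr hN (by nlinarith) (by omega)
    (by nlinarith [Nat.mul_le_mul_left (160000 * (r * r)) hN])
  refine ⟨g, hg, hgc, ?_⟩
  have hr0 : (0 : ℝ) < r := by exact_mod_cast hr
  have h4 : √(Q.card) ≤ 800 * r * √N := by
    rw [Real.sqrt_le_left (by positivity), mul_pow, Real.sq_sqrt (Nat.cast_nonneg _)]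
    have : Q.card ≤ (800 * r) ^ 2 * N := by nlinarith
    exact_mod_cast this
  calc ((touching Λ g).card : ℝ) * √(Q.card) ≤ (15 * (Λ.card / r)) * (800 * r * √N) := by gcongr
    _ = 12000 * Λ.card * √N := by field_simp; ring

/-! ### Ramsey theory. -/

/-- Multicolour Ramsey theorem, first step: a long sequence in which the colour of a pair depends
only on its first member. -/
lemma exists_prehomogeneous {κ : Type*} (K : Finset κ) (T : ℕ) :
    ∃ S : ℕ, ∀ {α : Type} (X : Finset α) (c : α → α → κ), (∀ a b, c a b ∈ K) → S ≤ X.card →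
      ∃ (l : List α) (χ : α → κ), l.length = T ∧ l.Nodup ∧ (∀ x ∈ l, x ∈ X) ∧
        (∀ a, χ a ∈ K) ∧ l.Pairwise fun a b => c a b = χ a := by
  classical
  induction T with
  | zero =>
    refine ⟨1, fun X c hc hX => ?_⟩
    obtain ⟨x, -⟩ := Finset.card_pos.1 hX
    exact ⟨[], fun a => c a x, by simp, by simp, by simp, fun a => hc a x, by simp⟩
  | succ T ih =>
    obtain ⟨S, hS⟩ := ih
    refine ⟨K.card * S + 1, fun X c hc hX => ?_⟩
    obtain ⟨x, hx⟩ := Finset.card_pos.1 (by omega : 0 < X.card)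
    obtain ⟨k, hk, hfib⟩ := Finset.exists_le_card_fiber_of_mul_le_card_of_maps_to
      (s := X.erase x) (t := K) (f := c x) (n := S) (fun a _ => hc x a) ⟨_, hc x x⟩
      (by rw [Finset.card_erase_of_mem hx]; omega)
    obtain ⟨l, χ, h1, h2, h3, h4, h5⟩ := hS _ c hc hfib
    have hne : ∀ a ∈ l, a ≠ x := fun a ha =>
      Finset.ne_of_mem_erase (Finset.mem_filter.1 (h3 a ha)).1
    refine ⟨x :: l, Function.update χ x k, by simp [h1],
      List.nodup_cons.2 ⟨fun h => hne x h rfl, h2⟩, ?_, ?_, ?_⟩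
    · intro a ha
      rcases List.mem_cons.1 ha with rfl | ha
      · exact hx
      · exact Finset.mem_of_mem_erase (Finset.mem_filter.1 (h3 a ha)).1
    · intro a
      by_cases ha : a = x
      · subst ha; simpa using hk
      · simpa [ha] using h4 a
    · refine List.pairwise_cons.2 ⟨fun a ha => ?_, ?_⟩
      · simpa using (Finset.mem_filter.1 (h3 a ha)).2
      · refine h5.imp_of_mem fun {a b} ha _ h => ?_
        rw [Function.update_of_ne (hne a ha), h]

/-- Ramsey's theorem for pairs and finitely many colours. -/
lemma exists_homogeneous {κ : Type*} (K : Finset κ) (t : ℕ) :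
    ∃ S : ℕ, ∀ {α : Type} (X : Finset α) (c : α → α → κ), (∀ a b, c a b ∈ K) →
      (∀ a b, c a b = c b a) → S ≤ X.card →
      ∃ Y ⊆ X, Y.card = t ∧ ∃ k, ∀ a ∈ Y, ∀ b ∈ Y, a ≠ b → c a b = k := by
  classical
  obtain ⟨S, hS⟩ := exists_prehomogeneous K (K.card * t)
  refine ⟨S + 1, fun X c hc hsymm hX => ?_⟩
  obtain ⟨x, -⟩ := Finset.card_pos.1 (by omega : 0 < X.card)
  obtain ⟨l, χ, h1, h2, h3, h4, h5⟩ := hS X c hc (by omega)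
  obtain ⟨k, -, hk⟩ := Finset.exists_le_card_fiber_of_mul_le_card_of_maps_to
    (s := l.toFinset) (t := K) (f := χ) (n := t) (fun a _ => h4 a) ⟨_, hc x x⟩
    (by rw [List.toFinset_card_of_nodup h2, h1])
  obtain ⟨Y, hY, hYc⟩ := Finset.exists_subset_card_eq hk
  have hmem : ∀ a ∈ Y, a ∈ l ∧ χ a = k := fun a ha => by simpa using hY ha
  refine ⟨Y, fun a ha => h3 a (hmem a ha).1, hYc, k, fun a ha b hb hab => ?_⟩
  have h6 : l.Pairwise fun a b => χ a = k → χ b = k → c a b = k :=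
    h5.imp fun {a b} h h' _ => h.trans h'
  have hs : Std.Symm fun a b => χ a = k → χ b = k → c a b = k :=
    ⟨fun a b h h1 h2 => (hsymm b a).trans (h h2 h1)⟩
  exact h6.forall (hmem a ha).1 (hmem b hb).1 hab (hmem a ha).2 (hmem b hb).2

/-- A large real matrix with distinct entries in each row and in each column has a `t × t`
submatrix in which all rows are ordered alike and all columns are ordered alike. -/
lemma exists_consistent_submatrix (t : ℕ) (ht : 1 ≤ t) :
    ∃ S : ℕ, ∀ {α : Type} (A B : Finset α) (X : α → α → ℝ), A.card = 2 * t → S ≤ B.card →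
      (∀ a ∈ A, ∀ b ∈ B, ∀ b' ∈ B, X a b = X a b' → b = b') →
      ∃ A' ⊆ A, ∃ B' ⊆ B, A'.card = t ∧ B'.card = t ∧
        (∀ a ∈ A', ∀ a' ∈ A', ∀ b ∈ B', ∀ b' ∈ B', X a b < X a' b → X a b' < X a' b') ∧
        (∀ a ∈ A', ∀ a' ∈ A', ∀ b ∈ B', ∀ b' ∈ B', X a b < X a b' → X a' b < X a' b') := by
  classical
  obtain ⟨S, hS⟩ := exists_homogeneous (Finset.univ : Finset (Finset (Fin (2 * t)))) t
  refine ⟨(Finset.univ : Finset (Finset (Fin (2 * t) × Fin (2 * t)))).card * S,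
    fun {α} A B X hA hB hrow => ?_⟩
  let e := Finset.equivFinOfCardEq hA
  let pat : α → Finset (Fin (2 * t) × Fin (2 * t)) := fun b =>
    Finset.univ.filter fun z => X (e.symm z.1) b < X (e.symm z.2) b
  obtain ⟨y, -, hy⟩ := Finset.exists_le_card_fiber_of_mul_le_card_of_maps_to
    (s := B) (t := Finset.univ) (f := pat) (n := S) (fun _ _ => Finset.mem_univ _)
    ⟨∅, Finset.mem_univ _⟩ hB
  set B₁ := B.filter fun b => pat b = y
  have hB₁ : ∀ b ∈ B₁, b ∈ B ∧ pat b = y := fun b hb => Finset.mem_filter.1 hb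
  let i0 : Fin (2 * t) := ⟨0, by omega⟩
  let P : α → α → Fin (2 * t) → Prop := fun b b' i => X (e.symm i) b < X (e.symm i) b'
  -- The colour is the set of rows that order `b`, `b'` as row `i0` does. Agreement does not depend
  -- on the order of the pair, so no ordering of `B` is needed; the default `∅` keeps symmetry
  -- outside `B`, where ties may occur.
  let c : α → α → Finset (Fin (2 * t)) := fun b b' =>
    if b ∈ B ∧ b' ∈ B then Finset.univ.filter fun i => P b b' i ↔ P b b' i0 else ∅
  have hc : ∀ b b', c b b' = c b' b := by
    intro b b'
    by_cases hbb : b ∈ B ∧ b' ∈ B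
    · simp only [c, hbb, and_self, if_true]
      by_cases hne : b = b'
      · rw [hne]
      have hP : ∀ i, P b b' i ↔ ¬ P b' b i := by
        intro i
        have := fun h => hne (hrow _ (e.symm i).2 b hbb.1 b' hbb.2 h)
        simp only [P, not_lt]
        exact ⟨le_of_lt, fun h => lt_of_le_of_ne h this⟩
      ext i
      simp only [Finset.mem_filter, Finset.mem_univ, true_and, hP]
      tauto
    · have hbb' : ¬ (b' ∈ B ∧ b ∈ B) := fun h => hbb h.symm
      simp [c, hbb, hbb']
  obtain ⟨B', hB'sub, hB'c, k, hk⟩ := hS B₁ c (fun _ _ => Finset.mem_univ _) hc hy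
  have hB' : ∀ b ∈ B', b ∈ B := fun b hb => (hB₁ b (hB'sub hb)).1
  -- On `B'`, rows in `k` all agree with row `i0` and the others all disagree. One of these classes
  -- contains `t` of the `2 * t` rows.
  obtain ⟨I, hIc, hI⟩ : ∃ I : Finset (Fin (2 * t)), I.card = t ∧
      ∀ i ∈ I, ∀ j ∈ I, (i ∈ k ↔ j ∈ k) := by
    have h1 : k.card + kᶜ.card = 2 * t := by simp
    rcases le_total t k.card with h | h
    · obtain ⟨I, hI, hc⟩ := Finset.exists_subset_card_eq h
      exact ⟨I, hc, fun i hi j hj => by simp [hI hi, hI hj]⟩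
    · obtain ⟨I, hI, hc⟩ := Finset.exists_subset_card_eq (s := kᶜ) (n := t) (by omega)
      refine ⟨I, hc, fun i hi j hj => ?_⟩
      have h2 := Finset.mem_compl.1 (hI hi)
      have h3 := Finset.mem_compl.1 (hI hj)
      simp [h2, h3]
  refine ⟨I.image fun i => (e.symm i : α), ?_, B', hB', ?_, hB'c, ?_, ?_⟩
  · intro a ha
    obtain ⟨i, -, rfl⟩ := Finset.mem_image.1 ha
    exact (e.symm i).2
  · exact (Finset.card_image_of_injective _
      (Subtype.val_injective.comp e.symm.injective)).trans hIc
  · intro a ha a' ha' b hb b' hb' h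
    obtain ⟨i, -, rfl⟩ := Finset.mem_image.1 ha
    obtain ⟨j, -, rfl⟩ := Finset.mem_image.1 ha'
    have h1 : (i, j) ∈ pat b := by simpa [pat] using h
    rw [(hB₁ b (hB'sub hb)).2, ← (hB₁ b' (hB'sub hb')).2] at h1
    simpa [pat] using h1
  · intro a ha a' ha' b hb b' hb' h
    obtain ⟨i, hi, rfl⟩ := Finset.mem_image.1 ha
    obtain ⟨j, hj, rfl⟩ := Finset.mem_image.1 ha'
    have hne : b ≠ b' := by rintro rfl; exact lt_irrefl _ h
    have h1 := hk b hb b' hb' hne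
    have h2 := hI i hi j hj
    rw [← h1] at h2
    simp only [c, hB' b hb, hB' b' hb', and_self, if_true, Finset.mem_filter, Finset.mem_univ,
      true_and] at h2
    have h3 : P b b' i := h
    have h4 : P b b' j := by tauto
    exact h4

/-! ### The graph of consecutive points. -/

/-- The point `b` follows the point `a` among the points of `g` on some line of `Λ`. -/
def Next (g Λ : Finset (ℝ × ℝ)) (a b : ℝ × ℝ) : Prop :=
  ∃ l ∈ Λ, a.2 = ev l a.1 ∧ b.2 = ev l b.1 ∧ a.1 < b.1 ∧
    ∀ c ∈ g, c.2 = ev l c.1 → ¬ (a.1 < c.1 ∧ c.1 < b.1)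

open Classical in
/-- The pairs of consecutive points of `g` on lines of `Λ`. -/
noncomputable def edges (g Λ : Finset (ℝ × ℝ)) : Finset ((ℝ × ℝ) × (ℝ × ℝ)) :=
  (g ×ˢ g).filter fun z => Next g Λ z.1 z.2

-- Every point on the line except the last has a successor, and a point is recovered from its pair.
open Classical in
lemma card_on_line_le (g : Finset (ℝ × ℝ)) (l : ℝ × ℝ) :
    (g.filter fun q => q.2 = ev l q.1).card ≤
      (if ∃ q ∈ g, q.2 = ev l q.1 then 1 else 0) + ((g ×ˢ g).filter fun z => z.1.2 = ev l z.1.1 ∧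
        z.2.2 = ev l z.2.1 ∧ z.1.1 < z.2.1 ∧
        ∀ c ∈ g, c.2 = ev l c.1 → ¬ (z.1.1 < c.1 ∧ c.1 < z.2.1)).card := by
  set S := g.filter fun q => q.2 = ev l q.1 with hS
  have hmem : ∀ q, q ∈ S ↔ q ∈ g ∧ q.2 = ev l q.1 := fun q => by simp [hS]
  rcases S.eq_empty_or_nonempty with h | h
  · simp [h]
  have hex : ∃ q ∈ g, q.2 = ev l q.1 := by
    obtain ⟨q, hq⟩ := h
    exact ⟨q, (hmem q).1 hq⟩
  rw [if_pos hex]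
  obtain ⟨M, hM, hmax⟩ := Finset.exists_max_image S Prod.fst h
  have hsucc : ∀ a ∈ S.erase M, ∃ b ∈ S, a.1 < b.1 ∧ ∀ c ∈ S, a.1 < c.1 → b.1 ≤ c.1 := by
    intro a ha
    obtain ⟨haM, ha⟩ := Finset.mem_erase.1 ha
    have h1 : a.1 < M.1 := lt_of_le_of_ne (hmax a ha)
      (point_fst_ne haM ((hmem a).1 ha).2 ((hmem M).1 hM).2)
    obtain ⟨b, hb, hmin⟩ := Finset.exists_min_image (S.filter fun b => a.1 < b.1) Prod.fst
      ⟨M, by simp [hM, h1]⟩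
    simp only [Finset.mem_filter] at hb hmin
    exact ⟨b, hb.1, hb.2, fun c hc hac => hmin c ⟨hc, hac⟩⟩
  choose! f hf1 hf2 hf3 using hsucc
  have hcard : (S.erase M).card + 1 = S.card := Finset.card_erase_add_one hM
  rw [← hcard, add_comm]
  refine Nat.add_le_add_left (Finset.card_le_card_of_injOn (fun a => (a, f a)) ?_ ?_) 1
  · intro a ha
    have ha' := (hmem a).1 (Finset.mem_of_mem_erase ha)
    have hb := (hmem _).1 (hf1 a ha)
    simp only [Finset.coe_filter, Finset.mem_product, Set.mem_ofPred_eq]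
    refine ⟨⟨ha'.1, hb.1⟩, ha'.2, hb.2, hf2 a ha, fun c hc hcl hlt => ?_⟩
    exact absurd (hf3 a ha c ((hmem c).2 ⟨hc, hcl⟩) hlt.1) (not_le.2 hlt.2)
  · intro a _ b _ hab
    exact (Prod.mk.inj hab).1

lemma inc_le_touching_add_edges (g Λ : Finset (ℝ × ℝ)) :
    inc g Λ ≤ (touching Λ g).card + (edges g Λ).card := by
  classical
  unfold inc
  refine (Finset.sum_le_sum fun l _ => card_on_line_le g l).trans ?_
  rw [Finset.sum_add_distrib]
  refine Nat.add_le_add ?_ ?_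
  · simp [touching]
  · rw [← Finset.card_biUnion]
    · refine Finset.card_le_card fun z hz => ?_
      simp only [Finset.mem_biUnion, Finset.mem_filter] at hz
      obtain ⟨l, hl, h1, h2⟩ := hz
      exact Finset.mem_filter.2 ⟨h1, l, hl, h2⟩
    · intro l _ l' _ hne
      refine Finset.disjoint_left.2 fun z hz hz' => hne ?_
      simp only [Finset.mem_filter] at hz hz'
      refine line_unique (q := z.1) (q' := z.2) ?_ hz.2.1 hz.2.2.1 hz'.2.1 hz'.2.2.1
      intro h
      have := hz.2.2.2.1
      rw [h] at this
      exact lt_irrefl _ this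

open Classical in
/-- The Kővári–Sós–Turán bound. -/
lemma kovari_sos_turan {α : Type*} (g : Finset α) (E : α → α → Prop) (s S : ℕ)
    (h : ∀ A ⊆ g, A.card = s + 1 → (g.filter fun b => ∀ a ∈ A, E a b).card ≤ S) :
    (((g ×ˢ g).filter fun z => E z.1 z.2).card - s * g.card) ^ (s + 1) ≤
      S * g.card ^ (2 * s + 1) := by
  set d : α → ℕ := fun b => (g.filter fun a => E a b).card with hd
  have h1 : ((g ×ˢ g).filter fun z => E z.1 z.2).card = ∑ b ∈ g, d b := by
    rw [Finset.card_filter, Finset.sum_product_right]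
    simp only [hd, Finset.card_filter]
  -- Double counting of the pairs of a vertex `b` and an `(s + 1)`-set of in-neighbours of `b`.
  have h2 : ∑ b ∈ g, (d b).choose (s + 1) ≤ g.card.choose (s + 1) * S := by
    have e1 : ∀ b, (d b).choose (s + 1) =
        ((g.powersetCard (s + 1)).filter fun A => ∀ a ∈ A, E a b).card := by
      intro b
      rw [hd, ← Finset.card_powersetCard]
      congr 1
      ext A
      simp only [Finset.mem_powersetCard, Finset.mem_filter, Finset.subset_iff]
      grind
    simp_rw [e1]
    have e2 := Finset.sum_card_bipartiteAbove_eq_sum_card_bipartiteBelow (s := g)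
      (t := g.powersetCard (s + 1)) (fun b (A : Finset α) => ∀ a ∈ A, E a b)
    simp only [Finset.bipartiteAbove, Finset.bipartiteBelow] at e2
    rw [e2, ← Finset.card_powersetCard]
    exact Finset.sum_le_card_nsmul _ _ S fun A hA =>
      h A (Finset.mem_powersetCard.1 hA).1 (Finset.mem_powersetCard.1 hA).2
  -- A falling factorial with `s + 1` factors is at least the power of its smallest factor;
  -- truncated subtraction covers degrees below `s`.
  have h3 : ∑ b ∈ g, (d b - s) ^ (s + 1) ≤ S * g.card ^ (s + 1) := by
    calc ∑ b ∈ g, (d b - s) ^ (s + 1) ≤ ∑ b ∈ g, (s + 1).factorial * (d b).choose (s + 1) := by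
          refine Finset.sum_le_sum fun b _ => ?_
          rw [← Nat.descFactorial_eq_factorial_mul_choose]
          have := Nat.pow_sub_le_descFactorial (d b) (s + 1)
          rwa [Nat.add_sub_add_right] at this
      _ = (s + 1).factorial * ∑ b ∈ g, (d b).choose (s + 1) := by rw [Finset.mul_sum]
      _ ≤ (s + 1).factorial * (g.card.choose (s + 1) * S) := Nat.mul_le_mul_left _ h2
      _ = S * g.card.descFactorial (s + 1) := by
          rw [Nat.descFactorial_eq_factorial_mul_choose]; ring
      _ ≤ S * g.card ^ (s + 1) := Nat.mul_le_mul_left _ (Nat.descFactorial_le_pow _ _)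
  have h4 : ∑ b ∈ g, d b - s * g.card ≤ ∑ b ∈ g, (d b - s) := by
    have : ∑ b ∈ g, d b ≤ ∑ b ∈ g, ((d b - s) + s) := Finset.sum_le_sum fun b _ => by omega
    rw [Finset.sum_add_distrib, Finset.sum_const, smul_eq_mul] at this
    rw [mul_comm]
    omega
  rw [h1]
  calc _ ≤ (∑ b ∈ g, (d b - s)) ^ (s + 1) := Nat.pow_le_pow_left h4 _
    _ ≤ g.card ^ s * ∑ b ∈ g, (d b - s) ^ (s + 1) :=
        pow_sum_le_card_mul_sum_pow (fun _ _ => Nat.zero_le _) s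
    _ ≤ g.card ^ s * (S * g.card ^ (s + 1)) := Nat.mul_le_mul_left _ h3
    _ = S * g.card ^ (2 * s + 1) := by ring

lemma le_of_sub_pow_le {e s S N : ℕ} (hN : 1 ≤ N) (hS : 1 ≤ S)
    (h : (e - s * N) ^ (s + 1) ≤ S * N ^ (2 * s + 1)) :
    (e : ℝ) ≤ (s + S) * (N : ℝ) ^ (2 - 1 / ((s : ℝ) + 1)) := by
  have hs : (0 : ℝ) < (s : ℝ) + 1 := by positivity
  have hN1 : (1 : ℝ) ≤ N := by exact_mod_cast hN
  have hS1 : (1 : ℝ) ≤ S := by exact_mod_cast hS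
  have hexp : (1 : ℝ) ≤ 2 - 1 / ((s : ℝ) + 1) := by
    have : 1 / ((s : ℝ) + 1) ≤ 1 := by
      rw [div_le_one hs]; linarith [Nat.cast_nonneg (α := ℝ) s]
    linarith
  have h1 : (N : ℝ) ≤ (N : ℝ) ^ (2 - 1 / ((s : ℝ) + 1)) := by
    simpa using Real.rpow_le_rpow_of_exponent_le hN1 hexp
  have h2 : ((e - s * N : ℕ) : ℝ) ≤ S * (N : ℝ) ^ (2 - 1 / ((s : ℝ) + 1)) := by
    refine le_of_pow_le_pow_left₀ (Nat.succ_ne_zero s) (by positivity) ?_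
    have h3 : (((e - s * N : ℕ) : ℝ)) ^ (s + 1) ≤ S * (N : ℝ) ^ (2 * s + 1) := by exact_mod_cast h
    refine h3.trans ?_
    rw [mul_pow]
    have h4 : ((N : ℝ) ^ (2 - 1 / ((s : ℝ) + 1))) ^ (s + 1) = (N : ℝ) ^ (2 * s + 1) := by
      rw [← Real.rpow_natCast, ← Real.rpow_mul (by positivity), ← Real.rpow_natCast]
      congr 1
      push_cast
      field_simp
      ring
    rw [h4]
    gcongr
    exact le_self_pow₀ hS1 (Nat.succ_ne_zero s)
  have h5 : (e : ℝ) ≤ ((e - s * N : ℕ) : ℝ) + s * N := by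
    have : e ≤ (e - s * N) + s * N := by omega
    exact_mod_cast this
  nlinarith [Nat.cast_nonneg (α := ℝ) s]

/-! ### Peeling off groups and optimising their size. -/

lemma inc_sdiff_add [DecidableEq (ℝ × ℝ)] {g Q : Finset (ℝ × ℝ)} (Λ : Finset (ℝ × ℝ))
    (hg : g ⊆ Q) : inc Q Λ = inc g Λ + inc (Q \ g) Λ := by
  classical
  simp only [← sum_degree_eq_inc]
  rw [add_comm]
  convert (Finset.sum_sdiff hg).symm

/-- If few pairs are consecutive in every group of `N` points, then there are few incidences. -/
lemma inc_le_of_groups (Λ : Finset (ℝ × ℝ)) {N : ℕ} (hN : 1 ≤ N) {E : ℝ} (hE : 0 ≤ E)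
    (Q : Finset (ℝ × ℝ)) (hQ : Q.card ≤ Λ.card)
    (h : ∀ g ⊆ Q, g.card = N → ((edges g Λ).card : ℝ) ≤ E) :
    (inc Q Λ : ℝ) ≤ 24000 * Λ.card * (√(Q.card) / √N) + Q.card / N * E +
      160000 * N * √(Λ.card) + Λ.card := by
  classical
  induction hm : Q.card using Nat.strong_induction_on generalizing Q with
  | _ m ih =>
  subst hm
  have hN0 : (0 : ℝ) < N := by exact_mod_cast hN
  by_cases hc : 160000 * N ≤ Q.card
  · obtain ⟨g, hg, hgc, ht⟩ := exists_group Q Λ hN hc hQ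
    have hcard : (Q \ g).card + N = Q.card := by
      rw [← hgc]; exact Finset.card_sdiff_add_card_eq_card hg
    have h1 := ih (Q \ g).card (by omega) (Q \ g) (by omega)
      (fun g' hg' => h g' (hg'.trans Finset.sdiff_subset)) rfl
    have h2 := h g hg hgc
    have h3 : (inc g Λ : ℝ) ≤ (touching Λ g).card + (edges g Λ).card := by
      exact_mod_cast inc_le_touching_add_edges g Λ
    have h4 : (inc Q Λ : ℝ) = inc g Λ + inc (Q \ g) Λ := by exact_mod_cast inc_sdiff_add Λ hg
    set M : ℝ := (Q.card : ℝ)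
    set k : ℝ := ((Q \ g).card : ℝ)
    have hMk : M = k + N := by simp only [M, k]; exact_mod_cast hcard.symm
    have hk0 : 0 ≤ k := Nat.cast_nonneg _
    have hM0 : 0 < M := by linarith
    have hsM : 0 < √M := Real.sqrt_pos.2 hM0
    have hsN : 0 < √(N : ℝ) := Real.sqrt_pos.2 hN0
    have hM2 : √M * √M = M := Real.mul_self_sqrt hM0.le
    have hk2 : √k * √k = k := Real.mul_self_sqrt hk0
    have hN2 : √(N : ℝ) * √(N : ℝ) = N := Real.mul_self_sqrt hN0.le
    have hsk : √k ≤ √M := Real.sqrt_le_sqrt (by linarith)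
    -- Telescoping: N = M - k = (√M - √k)(√M + √k) ≤ 2√M(√M - √k), so the cost of the group is paid
    -- by the drop of √M.
    have h5 : √(N : ℝ) / √M ≤ 2 * (√M / √N - √k / √N) := by
      rw [← sub_div, div_le_iff₀ hsM, mul_assoc, div_mul_eq_mul_div, mul_div_assoc',
        le_div_iff₀ hsN]
      nlinarith
    have h6 : ((touching Λ g).card : ℝ) ≤ 12000 * Λ.card * (√(N : ℝ) / √M) := by
      rw [mul_div_assoc', le_div_iff₀ hsM]; exact ht
    have h7 : 12000 * (Λ.card : ℝ) * (√(N : ℝ) / √M) ≤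
        12000 * Λ.card * (2 * (√M / √N - √k / √N)) := by gcongr
    have h8 : M / N * E = k / N * E + E := by rw [hMk]; field_simp
    rw [h4, h8]
    linarith
  · have h1 := inc_le Q Λ
    have h2 : (Q.card : ℝ) ≤ 160000 * N := by exact_mod_cast (not_le.1 hc).le
    have h3 : (Q.card : ℝ) * √(Λ.card) ≤ 160000 * N * √(Λ.card) := by gcongr
    have h4 : 0 ≤ 24000 * (Λ.card : ℝ) * (√(Q.card) / √N) := by positivity
    have h5 : 0 ≤ (Q.card : ℝ) / N * E := by positivity
    linarith

/-- The choice `N ≈ n ^ (1/3 + 1/(9t))` of the size of the groups. -/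
lemma inc_le_rpow (t K : ℕ) (ht : 1 ≤ t) (hK : 1 ≤ K) (n : ℕ) (hn : 1 ≤ n)
    (Q Λ : Finset (ℝ × ℝ)) (hΛ : Λ.card = n) (hQ : Q.card ≤ n)
    (h : ∀ g ⊆ Q, 1 ≤ g.card →
      ((edges g Λ).card : ℝ) ≤ K * (g.card : ℝ) ^ (2 - 1 / (2 * (t : ℝ)))) :
    (inc Q Λ : ℝ) ≤ (344001 + 2 * K) * (n : ℝ) ^ ((4 : ℝ) / 3 - 1 / (18 * t)) := by
  have ht1 : (1 : ℝ) ≤ t := by exact_mod_cast ht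
  have ht0 : (0 : ℝ) < t := by linarith
  have hn1 : (1 : ℝ) ≤ n := by exact_mod_cast hn
  have hn0 : (0 : ℝ) < n := by linarith
  set u : ℝ := 1 / (t : ℝ) with hu
  have hu0 : 0 < u := by positivity
  have hu1 : u ≤ 1 := by rw [hu, div_le_one ht0]; exact ht1
  have e1 : 1 / (18 * (t : ℝ)) = u / 18 := by rw [hu]; field_simp
  have e2 : 1 / (2 * (t : ℝ)) = u / 2 := by rw [hu]; field_simp
  rw [e1]
  rw [e2] at h
  -- The terms of `inc_le_of_groups` other than the final `n` get the exponents 4/3 - u/18, 4/3 -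
  -- u/18 - u²/18 and 5/6 + u/9, none above 4/3 - u/18 as u ≤ 1.
  set α : ℝ := 1 / 3 + u / 9 with hα
  set N : ℕ := ⌈(n : ℝ) ^ α⌉₊ with hN
  have hα0 : 0 ≤ α := by positivity
  have hnα : 1 ≤ (n : ℝ) ^ α := Real.one_le_rpow hn1 hα0
  have hN1 : 1 ≤ N := Nat.one_le_ceil_iff.2 (by linarith)
  have hN1' : (1 : ℝ) ≤ N := by exact_mod_cast hN1
  have hN0 : (0 : ℝ) < N := by linarith
  have hNl : (n : ℝ) ^ α ≤ N := Nat.le_ceil _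
  have hNu : (N : ℝ) ≤ 2 * (n : ℝ) ^ α := by
    have := Nat.ceil_lt_add_one (show 0 ≤ (n : ℝ) ^ α by linarith)
    linarith
  set E : ℝ := K * (N : ℝ) ^ (2 - u / 2) with hE
  have hmain := inc_le_of_groups Λ hN1 (E := E) (by positivity) Q (by omega)
    (fun g hg hgc => by have := h g hg (by omega); rwa [hgc] at this)
  rw [hΛ] at hmain
  set Z : ℝ := (n : ℝ) ^ ((4 : ℝ) / 3 - u / 18) with hZ
  have hQn : (Q.card : ℝ) ≤ n := by exact_mod_cast hQ
  have mono : ∀ {a b : ℝ}, a ≤ b → (n : ℝ) ^ a ≤ (n : ℝ) ^ b := fun hab =>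
    Real.rpow_le_rpow_of_exponent_le hn1 hab
  have t1 : 24000 * (n : ℝ) * (√(Q.card) / √N) ≤ 24000 * Z := by
    have h1 : √(Q.card : ℝ) / √N ≤ √n / √((n : ℝ) ^ α) := by
      gcongr
    have h2 : (n : ℝ) * (√n / √((n : ℝ) ^ α)) = Z := by
      rw [Real.sqrt_eq_rpow, Real.sqrt_eq_rpow, ← Real.rpow_mul hn0.le, ← Real.rpow_sub hn0,
        hZ]
      nth_rewrite 1 [← Real.rpow_one (n : ℝ)]
      rw [← Real.rpow_add hn0]
      congr 1
      rw [hα]; ring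
    calc 24000 * (n : ℝ) * (√(Q.card) / √N) ≤ 24000 * n * (√n / √((n : ℝ) ^ α)) := by gcongr
      _ = 24000 * Z := by rw [mul_assoc, h2]
  have t2 : (Q.card : ℝ) / N * E ≤ 2 * K * Z := by
    have h1 : (Q.card : ℝ) / N * E ≤ n / N * E := by gcongr
    have h2 : (n : ℝ) / N * E = K * (n * (N : ℝ) ^ (1 - u / 2)) := by
      have : (N : ℝ) ^ (2 - u / 2) = N * (N : ℝ) ^ (1 - u / 2) := by
        nth_rewrite 2 [← Real.rpow_one (N : ℝ)]
        rw [← Real.rpow_add hN0]; congr 1; ring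
      rw [hE, this]; field_simp
    have h3 : (N : ℝ) ^ (1 - u / 2) ≤ 2 * (n : ℝ) ^ (α * (1 - u / 2)) := by
      calc (N : ℝ) ^ (1 - u / 2) ≤ (2 * (n : ℝ) ^ α) ^ (1 - u / 2) :=
            Real.rpow_le_rpow hN0.le hNu (by linarith)
        _ = 2 ^ (1 - u / 2) * (n : ℝ) ^ (α * (1 - u / 2)) := by
            rw [Real.mul_rpow (by norm_num) (by positivity), Real.rpow_mul hn0.le]
        _ ≤ 2 * (n : ℝ) ^ (α * (1 - u / 2)) := by
            gcongr
            calc (2 : ℝ) ^ (1 - u / 2) ≤ 2 ^ (1 : ℝ) :=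
                  Real.rpow_le_rpow_of_exponent_le (by norm_num) (by linarith)
              _ = 2 := Real.rpow_one 2
    have h4 : (n : ℝ) * (n : ℝ) ^ (α * (1 - u / 2)) ≤ Z := by
      nth_rewrite 1 [← Real.rpow_one (n : ℝ)]
      rw [← Real.rpow_add hn0]
      refine mono ?_
      rw [hα]; nlinarith
    rw [h2] at h1
    refine h1.trans ?_
    calc (K : ℝ) * (n * (N : ℝ) ^ (1 - u / 2)) ≤ K * (n * (2 * (n : ℝ) ^ (α * (1 - u / 2)))) := by
          gcongr
      _ = 2 * K * (n * (n : ℝ) ^ (α * (1 - u / 2))) := by ring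
      _ ≤ 2 * K * Z := by gcongr
  have t3 : 160000 * (N : ℝ) * √n ≤ 320000 * Z := by
    have h1 : (n : ℝ) ^ α * √n ≤ Z := by
      rw [Real.sqrt_eq_rpow, ← Real.rpow_add hn0]
      refine mono ?_
      rw [hα]; linarith
    calc 160000 * (N : ℝ) * √n ≤ 160000 * (2 * (n : ℝ) ^ α) * √n := by gcongr
      _ = 320000 * ((n : ℝ) ^ α * √n) := by ring
      _ ≤ 320000 * Z := by gcongr
  have t4 : (n : ℝ) ≤ Z := by
    calc (n : ℝ) = (n : ℝ) ^ (1 : ℝ) := (Real.rpow_one _).symm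
      _ ≤ Z := mono (by linarith)
  linarith

/-! ### Grids in the dual. -/

/-- The abscissa of the crossing of the lines `y = a.1 * x + a.2` and `y = b.1 * x + b.2`. -/
noncomputable def crossX (a b : ℝ × ℝ) : ℝ := (b.2 - a.2) / (a.1 - b.1)

lemma crossX_comm (a b : ℝ × ℝ) : crossX a b = crossX b a := by
  rw [crossX, crossX, ← neg_sub a.2 b.2, ← neg_sub b.1 a.1, neg_div_neg_eq]

lemma crossX_mul {a b : ℝ × ℝ} (h : a.1 ≠ b.1) : (a.1 - b.1) * crossX a b = b.2 - a.2 := by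
  have := sub_ne_zero.2 h
  rw [crossX]; field_simp

/-- The crossing points of the lines `A` and the lines `B` form a grid: they are dual to lines
of `Λ`, and the lines of each family meet those of the other one in the same order. -/
structure DualGrid (A B Λ : Finset (ℝ × ℝ)) : Prop where
  lt : ∀ a ∈ A, ∀ b ∈ B, a.1 < b.1
  mem : ∀ a ∈ A, ∀ b ∈ B, (-crossX a b, a.1 * crossX a b + a.2) ∈ Λ
  row_inj : ∀ a ∈ A, ∀ b ∈ B, ∀ b' ∈ B, crossX a b = crossX a b' → b = b'
  col_inj : ∀ a ∈ A, ∀ a' ∈ A, ∀ b ∈ B, crossX a b = crossX a' b → a = a'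
  col : ∀ a ∈ A, ∀ a' ∈ A, ∀ b ∈ B, ∀ b' ∈ B,
    crossX a b < crossX a' b → crossX a b' < crossX a' b'
  row : ∀ a ∈ A, ∀ a' ∈ A, ∀ b ∈ B, ∀ b' ∈ B,
    crossX a b < crossX a b' → crossX a' b < crossX a' b'

/-- Duality: the line through the dual points `a` and `b` is the dual of the crossing of the primal
lines `a` and `b`. -/
lemma eq_of_on_both {a b l : ℝ × ℝ} (h : a.1 < b.1) (ha : a.2 = ev l a.1) (hb : b.2 = ev l b.1) :
    l = (-crossX a b, a.1 * crossX a b + a.2) := by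
  have h1 := crossX_mul h.ne
  simp only [ev] at ha hb
  have h2 : (a.1 - b.1) * (l.1 + crossX a b) = 0 := by linear_combination h1 - ha + hb
  have h3 : l.1 = -crossX a b := by
    rcases mul_eq_zero.1 h2 with h2 | h2
    · linarith
    · linarith
  refine Prod.ext h3 ?_
  rw [h3] at ha
  simp only
  linarith

lemma Next.mem {g Λ : Finset (ℝ × ℝ)} {a b : ℝ × ℝ} (h : Next g Λ a b) :
    (-crossX a b, a.1 * crossX a b + a.2) ∈ Λ := by
  obtain ⟨l, hl, ha, hb, hlt, -⟩ := h
  rwa [eq_of_on_both hlt ha hb] at hl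

/-- Equal crossings mean that `b` and `b'` follow `a` on the same dual line, where the successor is
unique. This is why consecutive pairs, and not all collinear pairs, are counted: the grid needs
distinct points. -/
lemma Next.right_unique {g Λ : Finset (ℝ × ℝ)} {a b b' : ℝ × ℝ} (hb : b ∈ g) (hb' : b' ∈ g)
    (h : Next g Λ a b) (h' : Next g Λ a b') (hX : crossX a b = crossX a b') : b = b' := by
  obtain ⟨l, -, h1, h2, h3, h4⟩ := h
  obtain ⟨l', -, h1', h2', h3', h4'⟩ := h'
  have hl : l = l' := by rw [eq_of_on_both h3 h1 h2, eq_of_on_both h3' h1' h2', hX]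
  subst hl
  by_contra hne
  rcases lt_or_gt_of_ne (point_fst_ne hne h2 h2') with h | h
  · exact h4' b hb h2 ⟨h3, h⟩
  · exact h4 b' hb' h2' ⟨h3', h⟩

lemma Next.left_unique {g Λ : Finset (ℝ × ℝ)} {a a' b : ℝ × ℝ} (ha : a ∈ g) (ha' : a' ∈ g)
    (h : Next g Λ a b) (h' : Next g Λ a' b) (hX : crossX a b = crossX a' b) : a = a' := by
  obtain ⟨l, -, h1, h2, h3, h4⟩ := h
  obtain ⟨l', -, h1', h2', h3', h4'⟩ := h'
  have hl : l = l' := by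
    have e := eq_of_on_both h3 h1 h2
    have e' := eq_of_on_both h3' h1' h2'
    have h5 : l.1 = l'.1 := by rw [e, e']; simp [hX]
    refine Prod.ext h5 ?_
    simp only [ev] at h2 h2'
    rw [h5] at h2
    linarith
  subst hl
  by_contra hne
  rcases lt_or_gt_of_ne (point_fst_ne hne h1 h1') with h | h
  · exact h4 a' ha' h1' ⟨h, h3'⟩
  · exact h4' a ha h1 ⟨h, h3⟩

lemma exists_dualGrid (t : ℕ) (ht : 1 ≤ t) :
    ∃ S : ℕ, ∀ g Λ A B : Finset (ℝ × ℝ), A ⊆ g → B ⊆ g → A.card = 2 * t → S ≤ B.card →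
      (∀ a ∈ A, ∀ b ∈ B, Next g Λ a b) →
      ∃ A' ⊆ A, ∃ B' ⊆ B, A'.card = t ∧ B'.card = t ∧ DualGrid A' B' Λ := by
  obtain ⟨S, hS⟩ := exists_consistent_submatrix t ht
  refine ⟨S, fun g Λ A B hA hB hAc hBc hN => ?_⟩
  obtain ⟨A', hA', B', hB', hA'c, hB'c, hcol, hrow⟩ := hS A B crossX hAc hBc
    fun a ha b hb b' hb' h => (hN a ha b hb).right_unique (hB hb) (hB hb') (hN a ha b' hb') h
  refine ⟨A', hA', B', hB', hA'c, hB'c, ?_, ?_, ?_, ?_, hcol, hrow⟩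
  · intro a ha b hb
    obtain ⟨l, -, -, -, h, -⟩ := hN a (hA' ha) b (hB' hb)
    exact h
  · exact fun a ha b hb => (hN a (hA' ha) b (hB' hb)).mem
  · exact fun a ha b hb b' hb' h => (hN a (hA' ha) b (hB' hb)).right_unique
      (hB (hB' hb)) (hB (hB' hb')) (hN a (hA' ha) b' (hB' hb')) h
  · exact fun a ha a' ha' b hb h => (hN a (hA' ha) b (hB' hb)).left_unique
      (hA (hA' ha)) (hA (hA' ha')) (hN a' (hA' ha') b (hB' hb)) h

/-! ### Lines and crossing points in the plane. -/

/-- The line `y = q.1 * x + q.2`. -/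
def lineOf (q : ℝ × ℝ) : AffineSubspace ℝ Plane where
  carrier := {p | p 1 = q.1 * p 0 + q.2}
  smul_vsub_vadd_mem' := by
    intro c p₁ p₂ p₃ h₁ h₂ h₃
    simp only [Set.mem_ofPred_eq, vsub_eq_sub, vadd_eq_add, PiLp.add_apply, PiLp.smul_apply,
      PiLp.sub_apply, smul_eq_mul] at *
    rw [h₁, h₂, h₃]; ring

lemma mem_lineOf {q : ℝ × ℝ} {p : Plane} : p ∈ lineOf q ↔ p 1 = q.1 * p 0 + q.2 := Iff.rfl

lemma lineOf_injective : Function.Injective lineOf := by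
  intro q q' h
  have h0 : (!₂[0, q.2] : Plane) ∈ lineOf q := by simp [mem_lineOf]
  have h1 : (!₂[1, q.1 + q.2] : Plane) ∈ lineOf q := by simp [mem_lineOf]
  rw [h, mem_lineOf] at h0 h1
  simp at h0 h1
  exact Prod.ext (by linarith) h0

lemma IsLine.vertical_or_lineOf {ℓ : AffineSubspace ℝ Plane} (h : IsLine ℓ) :
    (∃ x : ℝ, ∀ p : Plane, p ∈ ℓ ↔ p 0 = x) ∨ ∃ q, ℓ = lineOf q := by
  unfold IsLine at h
  obtain ⟨p₀, hp₀⟩ : (ℓ : Set Plane).Nonempty := by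
    rw [AffineSubspace.nonempty_iff_ne_bot]
    rintro rfl
    rw [AffineSubspace.direction_bot, finrank_bot] at h
    exact zero_ne_one h
  obtain ⟨⟨v, hv⟩, hv0, hspan⟩ := finrank_eq_one_iff'.1 h
  have hmem : ∀ p, p ∈ ℓ ↔ ∃ c : ℝ, p 0 = p₀ 0 + c * v 0 ∧ p 1 = p₀ 1 + c * v 1 := by
    intro p
    rw [← AffineSubspace.vsub_right_mem_direction_iff_mem hp₀]
    constructor
    · intro hp
      obtain ⟨c, hc⟩ := hspan ⟨_, hp⟩
      have hc' : c • v = p - p₀ := congrArg Subtype.val hc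
      have e0 := congrArg (fun w : Plane => w 0) hc'
      have e1 := congrArg (fun w : Plane => w 1) hc'
      simp at e0 e1
      exact ⟨c, by linarith, by linarith⟩
    · rintro ⟨c, h0, h1⟩
      have : p -ᵥ p₀ = c • v := by
        ext i
        fin_cases i
        · simp [h0]
        · simp [h1]
      rw [this]
      exact Submodule.smul_mem _ c hv
  by_cases h0 : v 0 = 0
  · left
    have h1 : v 1 ≠ 0 := by
      intro h1
      refine hv0 (Subtype.ext ?_)
      ext i
      fin_cases i
      · simpa using h0
      · simpa using h1
    refine ⟨p₀ 0, fun p => ?_⟩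
    rw [hmem]
    constructor
    · rintro ⟨c, hc, -⟩
      rw [hc, h0]; ring
    · intro hp
      exact ⟨(p 1 - p₀ 1) / v 1, by rw [h0, hp]; ring, by field_simp; ring⟩
  · right
    refine ⟨(v 1 / v 0, p₀ 1 - v 1 / v 0 * p₀ 0), ?_⟩
    ext p
    rw [hmem, mem_lineOf]
    constructor
    · rintro ⟨c, hc0, hc1⟩
      rw [hc0, hc1]; field_simp; ring
    · intro hp
      refine ⟨(p 0 - p₀ 0) / v 0, by field_simp; ring, ?_⟩
      rw [hp]; field_simp; ring

/-- The crossing point of the lines `a` and `b`. -/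
noncomputable def crossPt (a b : ℝ × ℝ) : Plane := !₂[crossX a b, a.1 * crossX a b + a.2]

lemma crossPt_comm {a b : ℝ × ℝ} (h : a.1 ≠ b.1) : crossPt a b = crossPt b a := by
  have := crossX_mul h
  ext i
  fin_cases i
  · simp [crossPt, crossX_comm a b]
  · simp only [crossPt, crossX_comm b a]
    simp
    linarith

lemma crossPt_eq {a b : ℝ × ℝ} (h : a.1 ≠ b.1) {p : Plane} (ha : p ∈ lineOf a)
    (hb : p ∈ lineOf b) : p = crossPt a b := by
  rw [mem_lineOf] at ha hb
  have h1 := crossX_mul h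
  have h2 : (a.1 - b.1) * (p 0 - crossX a b) = 0 := by linear_combination -h1 - ha + hb
  have h3 : p 0 = crossX a b := by
    rcases mul_eq_zero.1 h2 with h2 | h2
    · exact absurd (sub_eq_zero.1 h2) h
    · linarith
  ext i
  fin_cases i
  · simpa [crossPt] using h3
  · simpa [crossPt, ← h3] using ha

lemma crossPt_mem_left (a b : ℝ × ℝ) : crossPt a b ∈ lineOf a := by
  simp [mem_lineOf, crossPt]

lemma crossPt_mem_right {a b : ℝ × ℝ} (h : a.1 ≠ b.1) : crossPt a b ∈ lineOf b := by
  rw [crossPt_comm h]; exact crossPt_mem_left b a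

lemma gridPoints_eq [DecidableEq (AffineSubspace ℝ Plane)] {A B : Finset (ℝ × ℝ)}
    (h : ∀ a ∈ A, ∀ b ∈ B, a.1 ≠ b.1) :
    gridPoints (A.image lineOf) (B.image lineOf) =
      (fun z : (ℝ × ℝ) × (ℝ × ℝ) => crossPt z.1 z.2) '' ((A ×ˢ B : Finset _) : Set _) := by
  ext p
  simp only [gridPoints, Set.mem_ofPred_eq, Finset.mem_image, Set.mem_image, Finset.mem_coe,
    Finset.mem_product, Prod.exists]
  constructor
  · rintro ⟨-, ⟨a, a', ha, rfl⟩, -, ⟨b, b', hb, rfl⟩, hp⟩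
    have hp' : p ∈ (lineOf (a, a') : Set Plane) ∩ (lineOf (b, b') : Set Plane) := by
      rw [hp]; rfl
    exact ⟨a, a', b, b', ⟨ha, hb⟩, (crossPt_eq (h _ ha _ hb) hp'.1 hp'.2).symm⟩
  · rintro ⟨a, a', b, b', ⟨ha, hb⟩, rfl⟩
    refine ⟨_, ⟨a, a', ha, rfl⟩, _, ⟨b, b', hb, rfl⟩, ?_⟩
    ext p
    constructor
    · exact fun hp => crossPt_eq (h _ ha _ hb) hp.1 hp.2
    · rintro rfl
      exact ⟨crossPt_mem_left _ _, crossPt_mem_right (h _ ha _ hb)⟩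

/-! ### Consistent orders give natural grids. -/

lemma convex_halfPlane (u v w : ℝ) : Convex ℝ {p : Plane | u * p 0 + v * p 1 ≤ w} := by
  intro x hx y hy a b ha hb hab
  simp only [Set.mem_ofPred_eq, PiLp.add_apply, PiLp.smul_apply, smul_eq_mul] at *
  have h1 := mul_le_mul_of_nonneg_left hx ha
  have h2 := mul_le_mul_of_nonneg_left hy hb
  have h3 : a * w + b * w = w := by rw [← add_mul, hab, one_mul]
  linarith

/-- If the lines of the families `A` and `B` meet each other in consistent orders, then two lines
of `A` do not cross within the convex hull of the grid. -/
lemma not_mem_convexHull_of_consistent {σ : ℝ} {A B : Finset (ℝ × ℝ)}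
    (hlt : ∀ a ∈ A, ∀ b ∈ B, 0 < σ * (b.1 - a.1))
    (hinj : ∀ a ∈ A, ∀ a' ∈ A, ∀ b ∈ B, crossX a b = crossX a' b → a = a')
    (hcol : ∀ a ∈ A, ∀ a' ∈ A, ∀ b ∈ B, ∀ b' ∈ B,
      crossX a b < crossX a' b → crossX a b' < crossX a' b')
    (hrow : ∀ a ∈ A, ∀ a' ∈ A, ∀ b ∈ B, ∀ b' ∈ B,
      crossX a b < crossX a b' → crossX a' b < crossX a' b')
    (hB : B.Nonempty) {a a' : ℝ × ℝ} (ha : a ∈ A) (ha' : a' ∈ A) (hne : a ≠ a') {p : Plane}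
    (hp : p ∈ lineOf a) (hp' : p ∈ lineOf a') :
    p ∉ convexHull ℝ {x | ∃ a ∈ A, ∃ b ∈ B, x = crossPt a b} := by
  have hneq : ∀ a ∈ A, ∀ b ∈ B, a.1 ≠ b.1 := fun a ha b hb h => by
    have := hlt a ha b hb
    simp [h] at this
  rw [mem_lineOf] at hp hp'
  have hrel : ∀ b ∈ B, (a.1 - b.1) * (crossX a b - p 0) = (a'.1 - b.1) * (crossX a' b - p 0) := by
    intro b hb
    linear_combination crossX_mul (hneq a ha b hb) - crossX_mul (hneq a' ha' b hb) + hp - hp'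
  have hsign : ∀ b ∈ B, 0 < (crossX a' b - crossX a b) *
      ((crossX a b - p 0) * (σ * (a'.1 - a.1))) := by
    intro b hb
    have h1 : (crossX a' b - crossX a b) * (b.1 - a'.1) = (crossX a b - p 0) * (a'.1 - a.1) := by
      linear_combination hrel b hb
    have h2 : crossX a' b - crossX a b ≠ 0 := fun h => hne (hinj a ha a' ha' b hb (by linarith))
    have h3 : (crossX a' b - crossX a b) * ((crossX a b - p 0) * (σ * (a'.1 - a.1))) =
        (crossX a' b - crossX a b) ^ 2 * (σ * (b.1 - a'.1)) := by
      linear_combination (-(crossX a' b - crossX a b) * σ) * h1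
    rw [h3]
    exact mul_pos (by positivity) (hlt a' ha' b hb)
  have hcolsign : ∀ b ∈ B, ∀ b' ∈ B, 0 < crossX a' b - crossX a b →
      0 < crossX a' b' - crossX a b' := fun b hb b' hb' h =>
    sub_pos.2 (hcol a ha a' ha' b hb b' hb' (sub_pos.1 h))
  obtain ⟨b₀, hb₀⟩ := hB
  -- By `hsign` the order of `a` and `a'` along `b` tells on which side of `p` the line `b` meets
  -- `a`. That order is the same for all `b`, so all crossings on `a` lie on one side of `p`,
  -- recorded by the sign of `τ`.
  obtain ⟨τ, hτ⟩ : ∃ τ : ℝ, ∀ b ∈ B, 0 < τ * (crossX a b - p 0) := by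
    refine ⟨crossX a b₀ - p 0, fun b hb => ?_⟩
    have h1 := hsign b hb
    have h2 := hsign b₀ hb₀
    set k := σ * (a'.1 - a.1)
    by_cases h3 : 0 < crossX a' b₀ - crossX a b₀
    · have h4 := hcolsign b₀ hb₀ b hb h3
      have h5 := (mul_pos_iff_of_pos_left h4).1 h1
      have h6 := (mul_pos_iff_of_pos_left h3).1 h2
      nlinarith [mul_pos h5 h6, sq_nonneg k]
    · have h4 : ¬ 0 < crossX a' b - crossX a b := fun h => h3 (hcolsign b hb b₀ hb₀ h)
      have h5 : (crossX a b - p 0) * k < 0 := by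
        by_contra hc; push Not at hc h4; nlinarith
      have h6 : (crossX a b₀ - p 0) * k < 0 := by
        by_contra hc; push Not at hc h3; nlinarith
      nlinarith [mul_pos_of_neg_of_neg h5 h6, sq_nonneg k]
  -- The line `b₁` is the first one met on `a` when leaving `p`. By row consistency it is extreme on
  -- every line of `A`, so it bounds a closed half-plane that contains the grid but not `p`.
  obtain ⟨b₁, hb₁, hmin⟩ := Finset.exists_min_image B (fun b => τ * crossX a b) ⟨b₀, hb₀⟩
  have hmin' : ∀ a'' ∈ A, ∀ b ∈ B, 0 ≤ τ * (crossX a'' b - crossX a'' b₁) := by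
    intro a'' ha'' b hb
    have h1 := hmin b hb
    rcases lt_trichotomy (crossX a b) (crossX a b₁) with h | h | h
    · have := hrow a ha a'' ha'' b hb b₁ hb₁ h
      have : τ ≤ 0 := by by_contra hc; push Not at hc; nlinarith
      nlinarith
    · rcases lt_trichotomy (crossX a'' b) (crossX a'' b₁) with h' | h' | h'
      · exact absurd (hrow a'' ha'' a ha b hb b₁ hb₁ h') (by rw [h]; exact lt_irrefl _)
      · rw [h']; simp
      · exact absurd (hrow a'' ha'' a ha b₁ hb₁ b hb h') (by rw [h]; exact lt_irrefl _)
    · have := hrow a ha a'' ha'' b₁ hb₁ b hb h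
      have : 0 ≤ τ := by by_contra hc; push Not at hc; nlinarith
      nlinarith
  intro hmem
  have hsub : {x | ∃ a ∈ A, ∃ b ∈ B, x = crossPt a b} ⊆
      {z : Plane | (-(τ * σ * b₁.1)) * z 0 + (τ * σ) * z 1 ≤ τ * σ * b₁.2} := by
    rintro _ ⟨a'', ha'', b, hb, rfl⟩
    simp only [Set.mem_ofPred_eq, crossPt]
    simp
    have h1 := crossX_mul (hneq a'' ha'' b₁ hb₁)
    have h2 := mul_nonneg (hlt a'' ha'' b₁ hb₁).le (hmin' a'' ha'' b hb)
    linear_combination h2 + τ * σ * h1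
  have := convexHull_min hsub (convex_halfPlane _ _ _) hmem
  simp only [Set.mem_ofPred_eq] at this
  have h1 := crossX_mul (hneq a ha b₁ hb₁)
  have h2 := mul_pos (hlt a ha b₁ hb₁) (hτ b₁ hb₁)
  rw [hp] at this
  have h3 : σ * (b₁.1 - a.1) * (τ * (crossX a b₁ - p 0)) =
      τ * σ * ((a.1 - b₁.1) * p 0 + a.2 - b₁.2) := by linear_combination (-(σ * τ)) * h1
  linarith

lemma DualGrid.containsNaturalGrid {t : ℕ} (ht : 1 ≤ t) {A B Λ : Finset (ℝ × ℝ)}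
    (h : DualGrid A B Λ) (hA : A.card = t) (hB : B.card = t) {P : Finset Plane}
    {L : Finset (AffineSubspace ℝ Plane)} (hL : ∀ ℓ ∈ L, IsLine ℓ)
    (hAL : ∀ a ∈ A, lineOf a ∈ L) (hBL : ∀ b ∈ B, lineOf b ∈ L)
    (hP : ∀ x y : ℝ, (-x, y) ∈ Λ → !₂[x, y] ∈ P) : ContainsNaturalGrid t P L := by
  classical
  have hne : ∀ a ∈ A, ∀ b ∈ B, a.1 ≠ b.1 := fun a ha b hb => (h.lt a ha b hb).ne
  have hAL' : A.image lineOf ⊆ L := Finset.image_subset_iff.2 hAL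
  have hBL' : B.image lineOf ⊆ L := Finset.image_subset_iff.2 hBL
  have hG := gridPoints_eq hne
  have hA0 : A.Nonempty := Finset.card_pos.1 (by omega)
  have hB0 : B.Nonempty := Finset.card_pos.1 (by omega)
  have hset : gridPoints (A.image lineOf) (B.image lineOf) =
      {x | ∃ a ∈ A, ∃ b ∈ B, x = crossPt a b} := by
    rw [hG]
    ext x
    simp only [Set.mem_image, Finset.mem_coe, Finset.mem_product, Set.mem_ofPred_eq]
    constructor
    · rintro ⟨z, ⟨h1, h2⟩, rfl⟩; exact ⟨_, h1, _, h2, rfl⟩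
    · rintro ⟨a, ha, b, hb, rfl⟩; exact ⟨(a, b), ⟨ha, hb⟩, rfl⟩
  have hset' : gridPoints (A.image lineOf) (B.image lineOf) =
      {x | ∃ b ∈ B, ∃ a ∈ A, x = crossPt b a} := by
    rw [hset]
    ext x
    constructor
    · rintro ⟨a, ha, b, hb, rfl⟩; exact ⟨b, hb, a, ha, crossPt_comm (hne a ha b hb)⟩
    · rintro ⟨b, hb, a, ha, rfl⟩; exact ⟨a, ha, b, hb, (crossPt_comm (hne a ha b hb)).symm⟩
  refine ⟨A.image lineOf, B.image lineOf, ⟨fun ℓ hℓ => hL ℓ (hAL' hℓ), fun ℓ hℓ => hL ℓ (hBL' hℓ),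
    by rw [Finset.card_image_of_injective _ lineOf_injective, hA],
    by rw [Finset.card_image_of_injective _ lineOf_injective, hB], ?_, ?_, ?_⟩, hAL', hBL', ?_⟩
  · rw [hG, Set.InjOn.ncard_image, Set.ncard_coe_finset, Finset.card_product, hA, hB, sq]
    rintro ⟨a, b⟩ hz ⟨a', b'⟩ hz' heq
    simp only [Finset.coe_product, Set.mem_prod, Finset.mem_coe] at hz hz'
    simp only at heq
    have hx : ∀ a b, (crossPt a b) 0 = crossX a b := fun a b => by simp [crossPt]
    -- A point common to the four lines also lies on `a'` and `b`, so column injectivity applies.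
    have ha : a = a' := by
      by_contra hc
      refine hc (h.col_inj a hz.1 a' hz'.1 b hz.2 ?_)
      have h1 : crossPt a b = crossPt a' b :=
        crossPt_eq (hne a' hz'.1 b hz.2) (heq ▸ crossPt_mem_left a' b')
          (crossPt_mem_right (hne a hz.1 b hz.2))
      rw [← hx, h1, hx]
    subst ha
    have hb : b = b' := h.row_inj a hz.1 b hz.2 b' hz'.2 (by rw [← hx, heq, hx])
    rw [hb]
  · intro ℓ hℓ ℓ' hℓ' hℓne p hp hp'
    obtain ⟨a, ha, rfl⟩ := Finset.mem_image.1 hℓ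
    obtain ⟨a', ha', rfl⟩ := Finset.mem_image.1 hℓ'
    rw [hset]
    refine not_mem_convexHull_of_consistent (σ := 1) ?_ h.col_inj h.col h.row hB0 ha ha'
      (fun h => hℓne (by rw [h])) hp hp'
    intro a ha b hb
    linarith [h.lt a ha b hb]
  · intro ℓ hℓ ℓ' hℓ' hℓne p hp hp'
    obtain ⟨b, hb, rfl⟩ := Finset.mem_image.1 hℓ
    obtain ⟨b', hb', rfl⟩ := Finset.mem_image.1 hℓ'
    rw [hset']
    -- Exchanging the families reverses the slope inequality, whence `σ = -1`, and swaps rows with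
    -- columns.
    refine not_mem_convexHull_of_consistent (σ := -1) ?_ ?_ ?_ ?_ hA0 hb hb'
      (fun h => hℓne (by rw [h])) hp hp'
    · intro b hb a ha
      linarith [h.lt a ha b hb]
    · intro b hb b' hb' a ha heq
      rw [crossX_comm b a, crossX_comm b' a] at heq
      exact h.row_inj a ha b hb b' hb' heq
    · intro b hb b' hb' a ha a' ha' hlt
      rw [crossX_comm b, crossX_comm b'] at hlt ⊢
      exact h.row a ha a' ha' b hb b' hb' hlt
    · intro b hb b' hb' a ha a' ha' hlt
      rw [crossX_comm b a, crossX_comm b a'] at hlt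
      rw [crossX_comm b' a, crossX_comm b' a']
      exact h.col a ha a' ha' b hb b' hb' hlt
  · rw [hset]
    rintro _ ⟨a, ha, b, hb, rfl⟩
    exact hP _ _ (h.mem a ha b hb)

/-! ### Duality and conclusion. -/

/-- The dual line of a point. -/
noncomputable def dualLine (p : Plane) : ℝ × ℝ := (-p 0, p 1)

lemma dualLine_injective : Function.Injective dualLine := by
  intro p p' h
  simp only [dualLine, Prod.mk.injEq, neg_inj] at h
  ext i
  fin_cases i
  · exact h.1
  · exact h.2

/-- Passing to the dual loses at most one incidence per point, with a vertical line. -/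
lemma exists_dual (P : Finset Plane) (L : Finset (AffineSubspace ℝ Plane))
    (hL : ∀ ℓ ∈ L, IsLine ℓ) :
    open Classical in ∃ Q : Finset (ℝ × ℝ), (∀ q ∈ Q, lineOf q ∈ L) ∧ Q.card ≤ L.card ∧
      (incidences P L).ncard ≤ P.card + inc Q (P.image dualLine) := by
  classical
  set V := L.filter fun ℓ => ∃ x : ℝ, ∀ p : Plane, p ∈ ℓ ↔ p 0 = x
  set W := L.filter fun ℓ => ∃ q, ℓ = lineOf q
  have hVW : ∀ ℓ ∈ L, ℓ ∈ V ∨ ℓ ∈ W := fun ℓ hℓ => by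
    rcases (hL ℓ hℓ).vertical_or_lineOf with h | h
    · exact Or.inl (Finset.mem_filter.2 ⟨hℓ, h⟩)
    · exact Or.inr (Finset.mem_filter.2 ⟨hℓ, h⟩)
  have hW : ∀ ℓ ∈ W, ∃ q, ℓ = lineOf q := fun ℓ hℓ => (Finset.mem_filter.1 hℓ).2
  choose! f hf using hW
  refine ⟨W.image f, ?_, Finset.card_image_le.trans (Finset.card_filter_le _ _), ?_⟩
  · intro q hq
    obtain ⟨ℓ, hℓ, rfl⟩ := Finset.mem_image.1 hq
    rw [← hf ℓ hℓ]
    exact (Finset.mem_filter.1 hℓ).1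
  have hsub : incidences P L ⊆
      (((P ×ˢ V).filter fun z => z.1 ∈ z.2) ∪ ((P ×ˢ W).filter fun z => z.1 ∈ z.2) :
        Finset (Plane × AffineSubspace ℝ Plane)) := by
    rintro ⟨p, ℓ⟩ ⟨h1, h2, h3⟩
    simp only [Finset.coe_union, Finset.coe_filter, Finset.mem_product, Set.mem_union,
      Set.mem_ofPred_eq]
    simp only at h1 h2 h3
    rcases hVW ℓ h2 with h | h
    · exact Or.inl ⟨⟨h1, h⟩, h3⟩
    · exact Or.inr ⟨⟨h1, h⟩, h3⟩
  refine (Set.ncard_le_ncard hsub (Finset.finite_toSet _)).trans ?_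
  rw [Set.ncard_coe_finset]
  refine (Finset.card_union_le _ _).trans (Nat.add_le_add ?_ ?_)
  · refine Finset.card_le_card_of_injOn Prod.fst ?_ ?_
    · intro z hz
      exact (Finset.mem_product.1 (Finset.mem_filter.1 hz).1).1
    · rintro ⟨p, ℓ⟩ hz ⟨p', ℓ'⟩ hz' (rfl : p = p')
      simp only [Finset.coe_filter, Finset.mem_product, Set.mem_ofPred_eq] at hz hz'
      obtain ⟨x, hx⟩ := (Finset.mem_filter.1 hz.1.2).2
      obtain ⟨x', hx'⟩ := (Finset.mem_filter.1 hz'.1.2).2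
      have h1 := (hx p).1 hz.2
      have h2 := (hx' p).1 hz'.2
      have : ℓ = ℓ' := by
        ext w
        rw [hx, hx', ← h1, ← h2]
      rw [this]
  · unfold inc
    rw [← Finset.card_sigma]
    refine Finset.card_le_card_of_injOn (fun z => ⟨dualLine z.1, f z.2⟩) ?_ ?_
    · rintro ⟨p, ℓ⟩ hz
      simp only [Finset.coe_filter, Finset.mem_product, Set.mem_ofPred_eq] at hz
      simp only [Finset.coe_sigma, Set.mem_sigma_iff, Finset.mem_coe, Finset.mem_filter]
      refine ⟨Finset.mem_image_of_mem _ hz.1.1, Finset.mem_image_of_mem _ hz.1.2, ?_⟩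
      have h1 := hz.2
      rw [hf ℓ hz.1.2, mem_lineOf] at h1
      simp only [ev, dualLine]
      linarith
    · rintro ⟨p, ℓ⟩ hz ⟨p', ℓ'⟩ hz' heq
      simp only [Finset.coe_filter, Finset.mem_product, Set.mem_ofPred_eq] at hz hz'
      simp only [Sigma.mk.injEq, heq_eq_eq] at heq
      rw [dualLine_injective heq.1, hf ℓ hz.1.2, hf ℓ' hz'.1.2, heq.2]

theorem mainTheorem2 :
    ∃ ε : ℕ → ℝ,
      (∃ c : ℝ, 0 < c ∧ ∀ t : ℕ, 1 < t → c / (t : ℝ) ^ 2 ≤ ε t) ∧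
      ∀ t : ℕ, 1 < t → 0 < ε t ∧ ∃ C : ℝ, 0 < C ∧
        ∀ (n : ℕ) (P : Finset Plane) (L : Finset (AffineSubspace ℝ Plane)),
          P.card = n → L.card = n → (∀ ℓ ∈ L, IsLine ℓ) →
          ¬ ContainsNaturalGrid t P L →
          ((incidences P L).ncard : ℝ) ≤ C * (n : ℝ) ^ ((4 : ℝ) / 3 - ε t) := by
  classical
  refine ⟨fun t => 1 / (18 * t), ⟨1 / 18, by norm_num, fun t ht => ?_⟩, fun t ht => ⟨?_, ?_⟩⟩
  · have ht1 : (1 : ℝ) ≤ t := by exact_mod_cast ht.le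
    rw [div_div]
    refine one_div_le_one_div_of_le (by positivity) ?_
    nlinarith
  · have : (0 : ℝ) < t := by exact_mod_cast (by omega : 0 < t)
    positivity
  obtain ⟨S, hS⟩ := exists_dualGrid t ht.le
  obtain ⟨s, hs⟩ : ∃ s, s + 1 = 2 * t := ⟨2 * t - 1, by omega⟩
  -- One more than the constant of `inc_le_rpow`, to absorb the at most `n` incidences with vertical
  -- lines.
  refine ⟨344002 + 2 * ((s + (S + 1) : ℕ) : ℝ), by positivity, fun n P L hP hL hline hgrid => ?_⟩
  have ht1 : (1 : ℝ) ≤ t := by exact_mod_cast ht.le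
  obtain ⟨Q, hQL, hQc, hinc⟩ := exists_dual P L hline
  rcases Nat.eq_zero_or_pos n with rfl | hn
  · have h0 : (incidences P L).ncard = 0 := by
      have hP0 := Finset.card_eq_zero.1 hP
      have : incidences P L = ∅ := by
        ext z; simp [incidences, hP0]
      simp [this]
    rw [h0, Nat.cast_zero]
    exact mul_nonneg (by positivity) (Real.rpow_nonneg le_rfl _)
  have hmain := inc_le_rpow t (s + (S + 1)) ht.le (by omega) n hn Q (P.image dualLine)
    (by rw [Finset.card_image_of_injective _ dualLine_injective, hP]) (by omega) ?_
  · have hn1 : (1 : ℝ) ≤ n := by exact_mod_cast hn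
    have h1 : (n : ℝ) ≤ (n : ℝ) ^ ((4 : ℝ) / 3 - 1 / (18 * t)) := by
      have : 1 / (18 * (t : ℝ)) ≤ 1 / 18 :=
        one_div_le_one_div_of_le (by norm_num) (by linarith)
      simpa using Real.rpow_le_rpow_of_exponent_le hn1
        (by linarith : (1 : ℝ) ≤ (4 : ℝ) / 3 - 1 / (18 * t))
    have h2 : ((incidences P L).ncard : ℝ) ≤ n + inc Q (P.image dualLine) := by
      rw [← hP]; exact_mod_cast hinc
    simp only
    linarith
  · intro g hg hg1
    -- Sets of `s + 1 = 2 * t` points give the exponent 2 - 1/(2t); the Ramsey number affects only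
    -- the constant. `S + 1` replaces `S` because `le_of_sub_pow_le` needs a positive bound.
    have hkst := kovari_sos_turan g (Next g (P.image dualLine)) s (S + 1) ?_
    · have h1 := le_of_sub_pow_le hg1 (by omega : 1 ≤ S + 1) hkst
      have h2 : (s : ℝ) + 1 = 2 * t := by exact_mod_cast hs
      rw [h2] at h1
      refine h1.trans (le_of_eq ?_)
      push_cast
      ring
    · intro A hA hAc
      by_contra hc
      push Not at hc
      obtain ⟨A', hA', B', hB', hA'c, hB'c, hD⟩ := hS g (P.image dualLine) A
        (g.filter fun b => ∀ a ∈ A, Next g (P.image dualLine) a b) hA (Finset.filter_subset _ _)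
        (by omega) (by omega) (fun a ha b hb => (Finset.mem_filter.1 hb).2 a ha)
      refine hgrid (hD.containsNaturalGrid ht.le hA'c hB'c hline
        (fun a ha => hQL a (hg (hA (hA' ha))))
        (fun b hb => hQL b (hg (Finset.filter_subset _ _ (hB' hb)))) fun x y hxy => ?_)
      obtain ⟨p, hp, hpe⟩ := Finset.mem_image.1 hxy
      simp only [dualLine, Prod.mk.injEq, neg_inj] at hpe
      have : !₂[x, y] = p := by
        ext i
        fin_cases i
        · simp [hpe.1]
        · simp [hpe.2]
      rwa [this]
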